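/- Let $b>0$, let $A(x)=\frac b2(-x_2,x_1)$ for $x=(x_1,x_2)\in\mathbb R^2$, and let $\Pi(A)=(\Pi_1(A),\Pi_2(A))=-i\nabla-A$, acting in the sense of distributions. Let $\mathrm H^1_A(\mathbb R^2)=\{u\in L^2(\mathbb R^2):\Pi_1(A)u,\Pi_2(A)u\in L^2(\mathbb R^2)\}$ with its natural norm, and let $H_0=(-i\nabla-A)^2$ be the Landau Hamiltonian, i.e. the self-adjoint operator in $L^2(\mathbb R^2)$ generated by the closed quadratic form $\int_{\mathbb R^2}|\Pi(A)u|^2\,dx$, $u\in\mathrm H^1_A(\mathbb R^2)$. For $q\in\{0,1,2,\dots\}$ let $\Lambda_q=b(2q+1)$, and let $p_q$ be the orthogonal projection of $L^2(\mathbb R^2)$ onto $\ker(H_0-\Lambda_q)$. Let $\Gamma\subset\mathbb R^2$ be a $C^{1,1}$-smooth Jordan curve with arc length measure $ds$, and let $\tau$ be the Dirichlet trace operator, i.e. the continuous extension to $\mathrm H^1_A(\mathbb R^2)$ of the restriction map $\mathrm H^1_A(\mathbb R^2)\cap C(\mathbb R^2)\ni u\mapsto u|_\Gamma$. Let $p>1$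 and let $\upsilon\in L^p(\Gamma;\mathbb R)$ have constant sign ($\upsilon\ge 0$ a.e. on $\Gamma$, or $\upsilon\le0$ a.e. on $\Gamma$). The singular Berezin–Toeplitz operator $$T_q(\upsilon\delta_\Gamma)=(\tau p_q)^*\,\upsilon\,(\tau p_q)$$ is the bounded operator in the Hilbert space $p_qL^2(\mathbb R^2)=\ker(H_0-\Lambda_q)$ determined by $$\langle T_q(\upsilon\delta_\Gamma)u,v\rangle_{L^2(\mathbb R^2)}=\int_\Gamma \upsilon\,(\tau u)\,\overline{(\tau v)}\,ds,\qquad u,v\in p_qL^2(\mathbb R^2).$$ **Theorem.** If $\upsilon\neq0$ as an element of $L^p(\Gamma;\mathbb R)$, then for $q=0$ one has $\ker\big(T_0(\upsilon\delta_\Gamma)\big)=\{0\}$ (in $p_0L^2(\mathbb R^2)$). -/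

import Mathlib

open MeasureTheory Measure Set
open scoped ContDiff ENNReal NNReal

noncomputable section

namespace Landau

/-! ### The plane and the magnetic gradient

The plane `ℝ²` is identified with `ℂ` through `x = (x₁, x₂) = x₁ + i x₂`; smoothness,
differentiation and Lebesgue measure on `ℂ` are the real ones. -/

/-- The Hilbert space `L²(ℝ²)` of complex-valued functions. -/
abbrev L2 : Type := Lp ℂ 2 (volume : Measure ℂ)

/-- The coordinate directions `e₁ = (1, 0)`, `e₂ = (0, 1)`. -/
def dir : Fin 2 → ℂ := ![1, Complex.I]

/-- The magnetic potential `A(x) = (b/2) (-x₂, x₁)`. -/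
def vecPot (b : ℝ) (x : ℂ) : Fin 2 → ℝ := ![-(b / 2) * x.im, (b / 2) * x.re]

/-- `Π_j(A)† φ = i ∂_j φ - A_j φ`, the transpose of `Π_j(A) = -i ∂_j - A_j` with respect to the
bilinear pairing `(g, φ) ↦ ∫ g φ dx`. -/
def transposePi (b : ℝ) (j : Fin 2) (φ : ℂ → ℂ) (x : ℂ) : ℂ :=
  Complex.I * fderiv ℝ φ x (dir j) - (vecPot b x j : ℂ) * φ x

/-- `Π_j(A) u = g` in the sense of distributions, for `u, g ∈ L²(ℝ²)`. -/
def IsMagneticDeriv (b : ℝ) (j : Fin 2) (u g : L2) : Prop :=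
  ∀ φ : ℂ → ℂ, ContDiff ℝ ∞ φ → HasCompactSupport φ →
    ∫ x, g x * φ x = ∫ x, u x * transposePi b j φ x

theorem continuous_vecPot (b : ℝ) (j : Fin 2) : Continuous fun x => vecPot b x j := by
  fin_cases j
  · exact (continuous_const (y := -(b / 2))).mul Complex.continuous_im
  · exact (continuous_const (y := b / 2)).mul Complex.continuous_re

theorem continuous_transposePi (b : ℝ) (j : Fin 2) {φ : ℂ → ℂ} (h : ContDiff ℝ ∞ φ) :
    Continuous (transposePi b j φ) := by
  have h1 : Continuous fun x => fderiv ℝ φ x (dir j) :=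
    (h.continuous_fderiv (by simp)).clm_apply continuous_const
  have h2 := Complex.continuous_ofReal.comp (continuous_vecPot b j)
  exact (continuous_const.mul h1).sub (h2.mul h.continuous)

theorem hasCompactSupport_transposePi (b : ℝ) (j : Fin 2) {φ : ℂ → ℂ}
    (h : HasCompactSupport φ) : HasCompactSupport (transposePi b j φ) := by
  have h1 : HasCompactSupport fun x => fderiv ℝ φ x (dir j) := h.fderiv_apply (𝕜 := ℝ) (dir j)
  exact (h1.mul_left (f := fun _ => Complex.I)).sub
    (h.mul_left (f := fun x => (vecPot b x j : ℂ)))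

theorem memLp_of_test {φ : ℂ → ℂ} (h : Continuous φ) (hc : HasCompactSupport φ) :
    MemLp φ 2 (volume : Measure ℂ) := h.memLp_of_hasCompactSupport hc

theorem integrable_mul_test (u : L2) {φ : ℂ → ℂ} (h : Continuous φ)
    (hc : HasCompactSupport φ) : Integrable (fun x => u x * φ x) :=
  (Lp.memLp u).integrable_mul (memLp_of_test h hc)

theorem integral_add_mul (u v : L2) {φ : ℂ → ℂ} (h : Continuous φ)
    (hc : HasCompactSupport φ) :
    ∫ x, (u + v : L2) x * φ x = (∫ x, u x * φ x) + ∫ x, v x * φ x := by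
  rw [← integral_add (integrable_mul_test u h hc) (integrable_mul_test v h hc)]
  refine integral_congr_ae ?_
  filter_upwards [Lp.coeFn_add u v] with x hx
  rw [hx, Pi.add_apply, add_mul]

theorem integral_smul_mul (c : ℂ) (u : L2) (φ : ℂ → ℂ) :
    ∫ x, (c • u : L2) x * φ x = c * ∫ x, u x * φ x := by
  rw [← integral_const_mul]
  refine integral_congr_ae ?_
  filter_upwards [Lp.coeFn_smul c u] with x hx
  rw [hx, Pi.smul_apply, smul_eq_mul, mul_assoc]

theorem integral_zero_mul (φ : ℂ → ℂ) : ∫ x, (0 : L2) x * φ x = 0 := by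
  simpa only [zero_smul, zero_mul] using integral_smul_mul 0 (0 : L2) φ

/-! ### The magnetic Sobolev space and the Landau Hamiltonian -/

/-- The magnetic Sobolev space `H¹_A(ℝ²)`. An element `u` is recorded together with its
distributional derivatives, as the triple `(u, Π₁(A) u, Π₂(A) u)` of elements of `L²(ℝ²)`, so that
the Hilbert space norm of the triple is `‖u‖_{H¹_A}`. -/
def magneticSobolev (b : ℝ) : Submodule ℂ (PiLp 2 fun _ : Fin 3 => L2) where
  carrier := {w | ∀ j : Fin 2, IsMagneticDeriv b j (w 0) (w j.succ)}
  add_mem' := by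
    intro v w hv hw j φ hφ hc
    have h1 := continuous_transposePi b j hφ
    have h2 := hasCompactSupport_transposePi b j hc
    rw [PiLp.add_apply, PiLp.add_apply, integral_add_mul _ _ hφ.continuous hc,
      integral_add_mul _ _ h1 h2, hv j φ hφ hc, hw j φ hφ hc]
  zero_mem' := by
    intro j φ hφ hc
    rw [PiLp.zero_apply, PiLp.zero_apply, integral_zero_mul, integral_zero_mul]
  smul_mem' := by
    intro c w hw j φ hφ hc
    rw [PiLp.smul_apply, PiLp.smul_apply, integral_smul_mul, integral_smul_mul, hw j φ hφ hc]

/-- `H¹_A(ℝ²)` as a space of its own, with the norm of `H¹_A`. -/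
abbrev H1A (b : ℝ) : Type := magneticSobolev b

/-- The function `u ∈ L²(ℝ²)` underlying an element of `H¹_A(ℝ²)`. -/
def H1A.fn {b : ℝ} (w : H1A b) : L2 := (w : PiLp 2 fun _ : Fin 3 => L2) 0

/-- The component `Π_j(A) u ∈ L²(ℝ²)` of the magnetic gradient of `u ∈ H¹_A(ℝ²)`. -/
def H1A.grad {b : ℝ} (w : H1A b) (j : Fin 2) : L2 :=
  (w : PiLp 2 fun _ : Fin 3 => L2) j.succ

/-- The sesquilinear form `∫ ⟨Π(A) u, Π(A) v⟩ dx` on `H¹_A(ℝ²)`, linear in `u` (the second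
argument). -/
def energy {b : ℝ} (v u : H1A b) : ℂ := ∑ j : Fin 2, inner ℂ (v.grad j) (u.grad j)

/-- The graph of the operator associated with the quadratic form `∫ |Π(A) u|² dx`,
`u ∈ H¹_A(ℝ²)`: the pairs `(u, f)` with `u ∈ H¹_A(ℝ²)` and
`∫ ⟨Π(A) u, Π(A) v⟩ dx = ⟨f, v⟩` for all `v ∈ H¹_A(ℝ²)`. -/
def landauGraph (b : ℝ) : Submodule ℂ (L2 × L2) where
  carrier := {p | ∃ w : H1A b, w.fn = p.1 ∧ ∀ v : H1A b, energy v w = inner ℂ v.fn p.2}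
  add_mem' := by
    rintro p q ⟨w, hw, h⟩ ⟨w', hw', h'⟩
    refine ⟨w + w', ?_, fun v => ?_⟩
    · rw [Prod.fst_add, ← hw, ← hw']; rfl
    · rw [Prod.snd_add, inner_add_right, ← h, ← h', energy, energy, energy,
        ← Finset.sum_add_distrib]
      exact Finset.sum_congr rfl fun j _ => inner_add_right _ _ _
  zero_mem' := by
    refine ⟨0, rfl, fun v => ?_⟩
    rw [Prod.snd_zero, inner_zero_right, energy]
    exact Finset.sum_eq_zero fun j _ => inner_zero_right _
  smul_mem' := by
    rintro c p ⟨w, hw, h⟩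
    refine ⟨c • w, ?_, fun v => ?_⟩
    · rw [Prod.smul_fst, ← hw]; rfl
    · rw [Prod.smul_snd, inner_smul_right, ← h, energy, energy, Finset.mul_sum]
      exact Finset.sum_congr rfl fun j _ => inner_smul_right _ _ _

/-- An `L²` function which is orthogonal to all test functions is zero. -/
theorem eq_zero_of_test {g : L2}
    (h : ∀ φ : ℂ → ℂ, ContDiff ℝ ∞ φ → HasCompactSupport φ → ∫ x, g x * φ x = 0) : g = 0 := by
  have hl : LocallyIntegrable (g : ℂ → ℂ) volume := (Lp.memLp g).locallyIntegrable (by norm_num)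
  refine (Lp.eq_zero_iff_ae_eq_zero).2 ?_
  refine ae_eq_zero_of_integral_contDiff_smul_eq_zero hl fun ψ hψ hc => ?_
  have := h (fun x => (ψ x : ℂ)) (Complex.ofRealCLM.contDiff.comp hψ)
    (hc.comp_left (g := fun r : ℝ => (r : ℂ)) (by simp))
  rw [← this]
  refine integral_congr_ae (Filter.Eventually.of_forall fun x => ?_)
  simp [mul_comm]

/-- The distributional magnetic derivatives are unique: an element of `H¹_A(ℝ²)` is determined by
its underlying function. -/
theorem H1A.fn_injective {b : ℝ} : Function.Injective (H1A.fn : H1A b → L2) := by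
  intro v w h
  have h0 : (v : PiLp 2 fun _ : Fin 3 => L2) 0 = (w : PiLp 2 fun _ : Fin 3 => L2) 0 := h
  have key : ∀ j : Fin 2, (v : PiLp 2 fun _ : Fin 3 => L2) j.succ
      = (w : PiLp 2 fun _ : Fin 3 => L2) j.succ := by
    intro j
    have hz := eq_zero_of_test (g := v.grad j + (-1 : ℂ) • w.grad j) fun φ hφ hc => by
      rw [integral_add_mul _ _ hφ.continuous hc, integral_smul_mul]
      have e1 := v.2 j φ hφ hc
      have e2 := w.2 j φ hφ hc
      rw [h0] at e1
      have e : ∫ x, v.grad j x * φ x = ∫ x, w.grad j x * φ x := e1.trans e2.symm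
      rw [e]; ring
    rw [neg_one_smul, ← sub_eq_add_neg, sub_eq_zero] at hz
    exact hz
  refine Subtype.ext (PiLp.ext fun i => ?_)
  refine Fin.cases h0 key i

/-- Integration by parts for the magnetic gradient of test functions. -/
theorem integral_pi_mul_test (b : ℝ) (j : Fin 2) {ψ φ : ℂ → ℂ} (hψ : ContDiff ℝ ∞ ψ)
    (hψc : HasCompactSupport ψ) (hφ : ContDiff ℝ ∞ φ) :
    ∫ x, (-Complex.I * fderiv ℝ ψ x (dir j) - (vecPot b x j : ℂ) * ψ x) * φ x
      = ∫ x, ψ x * transposePi b j φ x := by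
  have dψ : Continuous fun x => fderiv ℝ ψ x (dir j) :=
    (hψ.continuous_fderiv (by simp)).clm_apply continuous_const
  have dφ : Continuous fun x => fderiv ℝ φ x (dir j) :=
    (hφ.continuous_fderiv (by simp)).clm_apply continuous_const
  have cA := Complex.continuous_ofReal.comp (continuous_vecPot b j)
  have i1 : Integrable (fun x => fderiv ℝ ψ x (dir j) * φ x) :=
    (dψ.mul hφ.continuous).integrable_of_hasCompactSupport
      ((hψc.fderiv_apply (𝕜 := ℝ) (dir j)).mul_right)
  have i2 : Integrable (fun x => ψ x * fderiv ℝ φ x (dir j)) :=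
    (hψ.continuous.mul dφ).integrable_of_hasCompactSupport hψc.mul_right
  have i3 : Integrable (fun x => ψ x * φ x) :=
    (hψ.continuous.mul hφ.continuous).integrable_of_hasCompactSupport hψc.mul_right
  have i4 : Integrable (fun x => (vecPot b x j : ℂ) * (ψ x * φ x)) :=
    (cA.mul (hψ.continuous.mul hφ.continuous)).integrable_of_hasCompactSupport
      (hψc.mul_right.mul_left)
  have ibp := integral_mul_fderiv_eq_neg_fderiv_mul_of_integrable (v := dir j) i1 i2 i3
    (fun x _ => hψ.differentiable (by simp) x) (fun x _ => hφ.differentiable (by simp) x)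
  have l : ∀ x, (-Complex.I * fderiv ℝ ψ x (dir j) - (vecPot b x j : ℂ) * ψ x) * φ x
      = -Complex.I * (fderiv ℝ ψ x (dir j) * φ x) - (vecPot b x j : ℂ) * (ψ x * φ x) :=
    fun x => by ring
  have r : ∀ x, ψ x * transposePi b j φ x
      = Complex.I * (ψ x * fderiv ℝ φ x (dir j)) - (vecPot b x j : ℂ) * (ψ x * φ x) :=
    fun x => by rw [transposePi]; ring
  simp_rw [l, r]
  rw [integral_sub (i1.const_mul _) i4, integral_sub (i2.const_mul _) i4, integral_const_mul,
    integral_const_mul, ibp]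
  ring

/-- Every test function is (the underlying function of) an element of `H¹_A(ℝ²)`. -/
theorem exists_H1A_of_test (b : ℝ) {ψ : ℂ → ℂ} (hψ : ContDiff ℝ ∞ ψ)
    (hc : HasCompactSupport ψ) : ∃ w : H1A b, (w.fn : ℂ → ℂ) =ᵐ[volume] ψ := by
  have dψ : ∀ j, MemLp (fun x => -Complex.I * fderiv ℝ ψ x (dir j) - (vecPot b x j : ℂ) * ψ x) 2
      (volume : Measure ℂ) := fun j => by
    refine memLp_of_test ?_ ?_
    · exact (continuous_const.mul ((hψ.continuous_fderiv (by simp)).clm_apply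
        continuous_const)).sub
        ((Complex.continuous_ofReal.comp (continuous_vecPot b j)).mul hψ.continuous)
    · exact ((hc.fderiv_apply (𝕜 := ℝ) (dir j)).mul_left (f := fun _ => -Complex.I)).sub
        (hc.mul_left (f := fun x => (vecPot b x j : ℂ)))
  have mψ := memLp_of_test hψ.continuous hc
  refine ⟨⟨WithLp.toLp 2 (Fin.cons mψ.toLp fun j => (dψ j).toLp), fun j φ hφ hφc => ?_⟩, ?_⟩
  · have e := integral_pi_mul_test b j hψ hc hφ
    have e1 : ∫ x, ((dψ j).toLp : L2) x * φ x
        = ∫ x, (-Complex.I * fderiv ℝ ψ x (dir j) - (vecPot b x j : ℂ) * ψ x) * φ x := by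
      refine integral_congr_ae ?_
      filter_upwards [(dψ j).coeFn_toLp] with x hx
      rw [hx]
    have e2 : ∫ x, (mψ.toLp : L2) x * transposePi b j φ x
        = ∫ x, ψ x * transposePi b j φ x := by
      refine integral_congr_ae ?_
      filter_upwards [mψ.coeFn_toLp] with x hx
      rw [hx]
    exact e1.trans (e.trans e2.symm)
  · exact mψ.coeFn_toLp

/-- `H¹_A(ℝ²)` is dense in `L²(ℝ²)`, so that the form determines an operator. -/
theorem landauGraph_snd_eq_zero (b : ℝ) :
    ∀ p ∈ landauGraph b, p.1 = 0 → p.2 = 0 := by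
  rintro p ⟨w, hw, h⟩ hp
  have hw0 : w = 0 := H1A.fn_injective (by rw [hw, hp]; rfl)
  have hv : ∀ v : H1A b, inner ℂ v.fn p.2 = 0 := fun v => by
    rw [← h v, hw0, energy]
    exact Finset.sum_eq_zero fun j _ => inner_zero_right _
  refine eq_zero_of_test fun φ hφ hc => ?_
  have hφ' : ContDiff ℝ ∞ fun x => (starRingEnd ℂ) (φ x) :=
    Complex.conjCLE.contDiff.comp hφ
  have hc' : HasCompactSupport fun x => (starRingEnd ℂ) (φ x) :=
    hc.comp_left (g := fun z : ℂ => (starRingEnd ℂ) z) (by simp)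
  obtain ⟨v, hvφ⟩ := exists_H1A_of_test b hφ' hc'
  rw [← hv v, L2.inner_def]
  refine integral_congr_ae ?_
  filter_upwards [hvφ] with x hx
  rw [hx]
  simp

/-- The Landau Hamiltonian `H₀ = (-i∇ - A)²`: the (unbounded, self-adjoint) operator in `L²(ℝ²)`
generated by the closed quadratic form `∫ |Π(A) u|² dx`, `u ∈ H¹_A(ℝ²)`. -/
def landauHamiltonian (b : ℝ) : L2 →ₗ.[ℂ] L2 := (landauGraph b).toLinearPMap

theorem graph_landauHamiltonian (b : ℝ) : (landauHamiltonian b).graph = landauGraph b :=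
  Submodule.toLinearPMap_graph_eq _ (landauGraph_snd_eq_zero b)

/-- The Landau levels `Λ_q = b (2q + 1)`. -/
def landauLevel (b : ℝ) (q : ℕ) : ℝ := b * (2 * q + 1)

/-- The eigenspace `ker (H₀ - Λ_q) = p_q L²(ℝ²)`, with the inner product of `L²(ℝ²)`. -/
def landauSpace (b : ℝ) (q : ℕ) : Submodule ℂ L2 where
  carrier := {u | ∃ h : u ∈ (landauHamiltonian b).domain,
    landauHamiltonian b ⟨u, h⟩ = (landauLevel b q : ℂ) • u}
  add_mem' := by
    rintro u v ⟨hu, eu⟩ ⟨hv, ev⟩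
    refine ⟨add_mem hu hv, ?_⟩
    rw [smul_add, ← eu, ← ev, ← LinearPMap.map_add]
    rfl
  zero_mem' := ⟨zero_mem _, by
    rw [smul_zero]
    exact LinearPMap.map_zero _⟩
  smul_mem' := by
    rintro c u ⟨hu, eu⟩
    refine ⟨Submodule.smul_mem _ c hu, ?_⟩
    rw [smul_comm, ← eu, ← LinearPMap.map_smul]
    rfl

/-! ### The curve and the trace -/

/-- A `C^{1,1}`-smooth Jordan curve in the plane, given by a `2π`-periodic regular parametrization
that is injective on a period and has a Lipschitz continuous derivative (that is, by a
`C^{1,1}`-diffeomorphism from the unit circle onto the curve). -/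
structure JordanCurve where
  /-- the parametrization -/
  param : ℝ → ℂ
  periodic : Function.Periodic param (2 * Real.pi)
  injOn : InjOn param (Ico 0 (2 * Real.pi))
  contDiff : ContDiff ℝ 1 param
  lipschitz_deriv : ∃ K : ℝ≥0, LipschitzWith K (deriv param)
  deriv_ne_zero : ∀ t, deriv param t ≠ 0

/-- The set of points of the curve. -/
def JordanCurve.carrier (Γ : JordanCurve) : Set ℂ := range Γ.param

/-- The arc length measure `ds` of the curve, as a measure on the plane carried by the curve:
the one-dimensional Hausdorff measure restricted to the curve. -/
def JordanCurve.arcLength (Γ : JordanCurve) : Measure ℂ := (μH[1] : Measure ℂ).restrict Γ.carrier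

theorem JordanCurve.carrier_eq_image (Γ : JordanCurve) :
    Γ.carrier = Γ.param '' Icc 0 (2 * Real.pi) := by
  refine Subset.antisymm ?_ (image_subset_range _ _)
  rintro _ ⟨t, rfl⟩
  obtain ⟨s, hs, e⟩ := Γ.periodic.exists_mem_Ico₀ Real.two_pi_pos t
  exact ⟨s, Ico_subset_Icc_self hs, e.symm⟩

theorem JordanCurve.isCompact_carrier (Γ : JordanCurve) : IsCompact Γ.carrier := by
  rw [Γ.carrier_eq_image]
  exact isCompact_Icc.image Γ.contDiff.continuous

instance JordanCurve.isFiniteMeasure_arcLength (Γ : JordanCurve) :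
    IsFiniteMeasure Γ.arcLength := by
  refine ⟨?_⟩
  rw [JordanCurve.arcLength, Measure.restrict_apply_univ, Γ.carrier_eq_image]
  obtain ⟨K, hK⟩ := LocallyLipschitzOn.exists_lipschitzOnWith_of_compact
    (isCompact_Icc (a := (0 : ℝ)) (b := 2 * Real.pi))
    (Γ.contDiff.locallyLipschitz.locallyLipschitzOn)
  refine (hK.hausdorffMeasure_image_le zero_le_one).trans_lt ?_
  rw [hausdorffMeasure_real, Real.volume_Icc]
  exact ENNReal.mul_lt_top (by simp) ENNReal.ofReal_lt_top

/-- The Hilbert space `L²(Γ)`. -/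
abbrev JordanCurve.L2 (Γ : JordanCurve) : Type := Lp ℂ 2 Γ.arcLength

theorem JordanCurve.memLp_of_continuous (Γ : JordanCurve) {f : ℂ → ℂ} (hf : Continuous f) :
    MemLp f 2 Γ.arcLength := by
  obtain ⟨C, hC⟩ := Γ.isCompact_carrier.exists_bound_of_continuousOn hf.continuousOn
  refine MemLp.of_bound hf.aestronglyMeasurable C ?_
  exact (ae_restrict_iff' Γ.isCompact_carrier.measurableSet).2
    (Filter.Eventually.of_forall fun x hx => hC x hx)

/-- The graph of the restriction map `H¹_A(ℝ²) ∩ C(ℝ²) → L²(Γ)`, `u ↦ u|_Γ`. -/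
def restrictionGraph (b : ℝ) (Γ : JordanCurve) : Submodule ℂ (H1A b × Γ.L2) where
  carrier := {p | ∃ f : ℂ → ℂ, Continuous f ∧ (p.1.fn : ℂ → ℂ) =ᵐ[volume] f ∧
    (p.2 : ℂ → ℂ) =ᵐ[Γ.arcLength] f}
  add_mem' := by
    rintro p q ⟨f, hf, h1, h2⟩ ⟨g, hg, k1, k2⟩
    refine ⟨f + g, hf.add hg, ?_, ?_⟩
    · exact (Lp.coeFn_add p.1.fn q.1.fn).trans (h1.add k1)
    · exact (Lp.coeFn_add p.2 q.2).trans (h2.add k2)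
  zero_mem' := ⟨0, continuous_zero, Lp.coeFn_zero _ _ _, Lp.coeFn_zero _ _ _⟩
  smul_mem' := by
    rintro c p ⟨f, hf, h1, h2⟩
    refine ⟨c • f, hf.const_smul c, ?_, ?_⟩
    · exact (Lp.coeFn_smul c p.1.fn).trans (h1.const_smul c)
    · exact (Lp.coeFn_smul c p.2).trans (h2.const_smul c)

/-- A continuous function is determined by its class in `L²(ℝ²)`, so the restriction is well
defined. -/
theorem restrictionGraph_snd_eq_zero (b : ℝ) (Γ : JordanCurve) :
    ∀ p ∈ restrictionGraph b Γ, p.1 = 0 → p.2 = 0 := by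
  rintro p ⟨f, hf, h1, h2⟩ hp
  have h0 : f =ᵐ[(volume : Measure ℂ)] (0 : ℂ → ℂ) := by
    refine h1.symm.trans ?_
    rw [hp]
    exact Lp.coeFn_zero _ _ _
  have hf0 : f = 0 := (hf.ae_eq_iff_eq volume continuous_zero).1 h0
  rw [hf0] at h2
  exact (Lp.eq_zero_iff_ae_eq_zero).2 h2

/-- The restriction map `H¹_A(ℝ²) ∩ C(ℝ²) → L²(Γ)`, `u ↦ u|_Γ`, as a linear map with domain
`H¹_A(ℝ²) ∩ C(ℝ²)`. -/
def restriction (b : ℝ) (Γ : JordanCurve) : H1A b →ₗ.[ℂ] Γ.L2 :=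
  (restrictionGraph b Γ).toLinearPMap

theorem graph_restriction (b : ℝ) (Γ : JordanCurve) :
    (restriction b Γ).graph = restrictionGraph b Γ :=
  Submodule.toLinearPMap_graph_eq _ (restrictionGraph_snd_eq_zero b Γ)

/-- The Dirichlet trace operator `τ` on `H¹_A(ℝ²)`: the continuous extension of the restriction
map. The restriction map is densely defined and bounded from `H¹_A(ℝ²)` to `L²(Γ)`, and for such a
map the closure is the continuous extension to the whole space. -/
def traceOp (b : ℝ) (Γ : JordanCurve) : H1A b →ₗ.[ℂ] Γ.L2 := (restriction b Γ).closure

open Classical in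
/-- The trace `τ u` of a function `u ∈ L²(ℝ²)` that belongs to `H¹_A(ℝ²)` (and `0` for a function
outside of `H¹_A(ℝ²)`). -/
def trace (b : ℝ) (Γ : JordanCurve) (u : L2) : Γ.L2 :=
  if h : ∃ w : (traceOp b Γ).domain, H1A.fn (w : H1A b) = u then traceOp b Γ h.choose else 0

/-! ### The singular Berezin–Toeplitz operator -/

/-- The form `⟨υ τ p_q u, τ p_q v⟩ = ∫_Γ υ (τ u) conj(τ v) ds` for `u, v ∈ p_q L²(ℝ²)`, linear in
`u` (the second argument). -/
def toeplitzForm (b : ℝ) (Γ : JordanCurve) (υ : ℂ → ℝ) (q : ℕ) (v u : landauSpace b q) : ℂ :=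
  ∫ x, (υ x : ℂ) * trace b Γ u x * (starRingEnd ℂ) (trace b Γ v x) ∂Γ.arcLength

/-- `T = (τ p_q)^* υ (τ p_q)` in `p_q L²(ℝ²)`: the function `υ |τ u| |τ v|` is integrable over `Γ`
and `⟨T u, v⟩ = ⟨υ τ p_q u, τ p_q v⟩` for all `u, v ∈ p_q L²(ℝ²)`. -/
def IsToeplitz (b : ℝ) (Γ : JordanCurve) (υ : ℂ → ℝ) (q : ℕ)
    (T : landauSpace b q →L[ℂ] landauSpace b q) : Prop :=
  ∀ u v : landauSpace b q,
    Integrable (fun x => (υ x : ℂ) * trace b Γ u x * (starRingEnd ℂ) (trace b Γ v x))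
      Γ.arcLength ∧
    inner ℂ v (T u) = toeplitzForm b Γ υ q v u

theorem IsToeplitz.unique {b : ℝ} {Γ : JordanCurve} {υ : ℂ → ℝ} {q : ℕ}
    {S T : landauSpace b q →L[ℂ] landauSpace b q} (hS : IsToeplitz b Γ υ q S)
    (hT : IsToeplitz b Γ υ q T) : S = T := by
  ext1 u
  exact ext_inner_left ℂ fun v => (hS u v).2.trans (hT u v).2.symm

open Classical in
/-- The singular Berezin–Toeplitz operator `T_q(υ δ_Γ) = (τ p_q)^* υ (τ p_q)`, a bounded operator
in `p_q L²(ℝ²)`. (The value is `0` if there were no bounded operator of this kind.) -/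
def singularToeplitz (b : ℝ) (Γ : JordanCurve) (υ : ℂ → ℝ) (q : ℕ) :
    landauSpace b q →L[ℂ] landauSpace b q :=
  if h : ∃ T, IsToeplitz b Γ υ q T then h.choose else 0

end Landau

end

/-! Up to the factor `exp (-b|x|²/4)`, the lowest Landau level consists of entire functions. If `T u
= 0`, pairing with `u` gives `∫_Γ υ |τ u|² ds = 0`; since `υ` has constant sign, `u` vanishes at
almost every point of `{υ ≠ 0}`. This subset of `Γ` has positive length, hence is infinite because
`μH[1]` has no atoms. By compactness of `Γ` the zeros of the entire factor accumulate, and the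
identity theorem gives `u = 0` (`eq_zero_of_infinite_zeros`).

The entire factor has to be extracted from an eigenspace defined by a form. In the sense of
distributions `(Π₁ - iΠ₂)(Π₁ + iΠ₂) = H₀ - b`, so `g = (Π₁ + iΠ₂)u` is killed by `Π₁ - iΠ₂`. Then
`exp (-b|x|²/4)` times the conjugate of `g` is weakly holomorphic and square integrable, so `g = 0`
by Weyl's lemma and Liouville (`grad_add_I_mul_grad_ae_eq_zero`). Now `(Π₁ + iΠ₂)u = 0` says that
`exp (b|x|²/4) u` is weakly holomorphic, and Weyl's lemma applies again
(`exists_differentiable_of_mem_landauSpace`).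

The operator must also be shown to exist, since otherwise `singularToeplitz` is the default `0`,
whose kernel is everything. Point evaluations are bounded uniformly on `Γ`
(`exists_norm_contRep_le`), so the form is bounded on the complete space `landauSpace b 0` and is
represented by an operator (`exists_isToeplitz`). -/

noncomputable section

namespace Landau

/-! ### Weakly holomorphic functions -/

open Filter Topology ContinuousLinearMap

/-- Convolution with a function which is invariant under rotations and has integral one does not
change entire functions. -/
theorem convolution_eq_self_of_rotation_invariant {ρ : ℂ → ℝ} (hρ : Continuous ρ)
    (hc : HasCompactSupport ρ) (hrot : ∀ w z : ℂ, ‖w‖ = 1 → ρ (w * z) = ρ z)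
    (hint : ∫ z, ρ z = 1) {h : ℂ → ℂ} (hh : Differentiable ℂ h) :
    convolution ρ h (lsmul ℝ ℝ) volume = h := by
  ext x
  have hi : Integrable ρ := hρ.integrable_of_hasCompactSupport hc
  -- Rotations preserve both Lebesgue measure and `ρ`, so the convolution equals its average over
  -- all rotations of the variable; the mean value property is then applied inside the integral.
  have hstep : ∀ θ : ℝ, ∫ t, ρ t • h (x - circleMap 0 1 θ * t)
      = convolution ρ h (lsmul ℝ ℝ) volume x := by
    intro θ
    have hw : ‖circleMap 0 1 θ‖ = 1 := by simp
    let w : Circle := ⟨circleMap 0 1 θ, by simp [Submonoid.unitSphere]⟩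
    have := (rotation w).measurePreserving.integral_comp
      (rotation w).toHomeomorph.measurableEmbedding (fun t => ρ t • h (x - t))
    rw [convolution_def]
    simp only [lsmul_apply]
    rw [← this]
    refine integral_congr_ae (.of_forall fun t => ?_)
    have e : rotation w t = circleMap 0 1 θ * t := _root_.rotation_apply w t
    simp only [e, hrot _ _ hw]
  have hmean : ∀ t, ∫ θ in Ioc 0 (2 * Real.pi), h (x - circleMap 0 1 θ * t)
      = ((2 * Real.pi : ℝ) : ℂ) * h x := by
    intro t
    have hd : Differentiable ℂ fun w => h (x - w * t) :=
      hh.comp ((differentiable_const x).sub (differentiable_id.mul_const t))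
    have := (hd.diffContOnCl (s := Metric.ball 0 |1|)).circleAverage
    rw [Real.circleAverage_def, intervalIntegral.integral_of_le Real.two_pi_pos.le,
      inv_smul_eq_iff₀ Real.two_pi_pos.ne'] at this
    simpa using this
  obtain ⟨M, hM⟩ : ∃ M, ∀ t ∈ tsupport ρ, ∀ θ, ‖h (x - circleMap 0 1 θ * t)‖ ≤ M := by
    obtain ⟨R, hR⟩ := hc.isCompact.isBounded.exists_norm_le
    obtain ⟨M, hM⟩ := (isCompact_closedBall x R).exists_bound_of_continuousOn
      hh.continuous.continuousOn
    refine ⟨M, fun t ht θ => hM _ ?_⟩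
    simpa [dist_eq_norm] using hR t ht
  have hcont : Continuous fun q : ℝ × ℂ => ρ q.2 • h (x - circleMap 0 1 q.1 * q.2) :=
    (hρ.comp continuous_snd).smul (hh.continuous.comp (continuous_const.sub
      (((continuous_circleMap 0 1).comp continuous_fst).mul continuous_snd)))
  have hprod : Integrable (fun q : ℝ × ℂ => ρ q.2 • h (x - circleMap 0 1 q.1 * q.2))
      ((volume.restrict (Ioc 0 (2 * Real.pi))).prod volume) := by
    refine Integrable.mono' ((hi.norm.mul_const M).comp_snd _) hcont.aestronglyMeasurable
      (.of_forall fun q => ?_)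
    rw [norm_smul]
    by_cases hq : q.2 ∈ tsupport ρ
    · exact mul_le_mul_of_nonneg_left (hM _ hq _) (norm_nonneg _)
    · simp [image_eq_zero_of_notMem_tsupport hq]
  have hswap := integral_integral_swap (f := fun (θ : ℝ) t =>
    ρ t • h (x - circleMap 0 1 θ * t)) hprod
  simp only [hstep, integral_smul, hmean] at hswap
  rw [integral_smul_const, hint, one_smul, setIntegral_const] at hswap
  have h2 : ((2 * Real.pi : ℝ) : ℂ) ≠ 0 := by exact_mod_cast Real.two_pi_pos.ne'
  refine mul_left_cancel₀ h2 ?_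
  rw [← hswap]
  simp [Real.pi_pos.le]

/-- There is a smooth compactly supported function on the plane such that convolution with it does
not change entire functions. -/
theorem exists_entire_mollifier : ∃ ρ : ℂ → ℝ, ContDiff ℝ ∞ ρ ∧ HasCompactSupport ρ ∧
    ∀ h : ℂ → ℂ, Differentiable ℂ h → convolution ρ h (lsmul ℝ ℝ) volume = h := by
  let χ : ContDiffBump (0 : ℝ) := ⟨1, 2, one_pos, one_lt_two⟩
  -- The square of the norm keeps the radial bump smooth at the origin.
  let ρ₀ : ℂ → ℝ := fun z => χ (‖z‖ ^ 2)
  have hs : ContDiff ℝ ∞ ρ₀ := χ.contDiff.comp (contDiff_norm_sq ℝ)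
  have hc : HasCompactSupport ρ₀ := by
    refine HasCompactSupport.intro (isCompact_closedBall 0 2) fun z hz => ?_
    refine χ.zero_of_le_dist ?_
    rw [Metric.mem_closedBall, dist_zero_right, not_le] at hz
    rw [dist_zero_right, Real.norm_of_nonneg (sq_nonneg _)]
    change 2 ≤ ‖z‖ ^ 2
    nlinarith
  have hpos : 0 < ∫ z, ρ₀ z := by
    refine hs.continuous.integral_pos_of_hasCompactSupport_nonneg_nonzero hc
      (fun z => χ.nonneg) (x := 0) ?_
    have : ρ₀ 0 = 1 := χ.one_of_mem_closedBall (by simp [χ])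
    rw [this]; exact one_ne_zero
  refine ⟨fun z => (∫ z, ρ₀ z)⁻¹ * ρ₀ z, contDiff_const.mul hs, hc.mul_left, fun h hh => ?_⟩
  refine convolution_eq_self_of_rotation_invariant (continuous_const.mul hs.continuous)
    hc.mul_left (fun w z hw => ?_) ?_ hh
  · simp [ρ₀, hw]
  · exact (integral_const_mul _ _).trans (inv_mul_cancel₀ hpos.ne')

/-- The equation `∂̄ f = 0` in the sense of distributions. -/
def IsWeaklyHolomorphic (f : ℂ → ℂ) : Prop :=
  ∀ φ : ℂ → ℂ, ContDiff ℝ ∞ φ → HasCompactSupport φ →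
    ∫ x, f x * (fderiv ℝ φ x 1 + Complex.I * fderiv ℝ φ x Complex.I) = 0

/-- The mollification of a weakly holomorphic function is entire. -/
theorem IsWeaklyHolomorphic.differentiable_convolution {f : ℂ → ℂ} (hf : IsWeaklyHolomorphic f)
    (hl : LocallyIntegrable f) {ρ : ℂ → ℝ} (hρ : ContDiff ℝ ∞ ρ) (hc : HasCompactSupport ρ) :
    Differentiable ℂ (convolution ρ f (lsmul ℝ ℝ) volume) := by
  intro x
  have hd := hc.hasFDerivAt_convolution_left (lsmul ℝ ℝ) (hρ.of_le (by norm_num)) hl x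
  -- What remains besides real differentiability is the Cauchy–Riemann equation at `x`; it is the
  -- weak equation for `f` tested against `t ↦ ρ (x - t)`.
  rw [differentiableAt_complex_iff_differentiableAt_real]
  refine ⟨hd.differentiableAt, ?_⟩
  have hex : ConvolutionExistsAt (fderiv ℝ ρ) f x
      ((lsmul ℝ ℝ : ℝ →L[ℝ] ℂ →L[ℝ] ℂ).precompL ℂ) volume :=
    (hc.fderiv (𝕜 := ℝ)).convolutionExists_left _ (hρ.continuous_fderiv (by norm_num)) hl x
  have hval : ∀ v : ℂ, fderiv ℝ (convolution ρ f (lsmul ℝ ℝ) volume) x v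
      = ∫ t, fderiv ℝ ρ (x - t) v • f t := by
    intro v
    rw [hd.fderiv, convolution_def, ContinuousLinearMap.integral_apply hex,
      ← integral_sub_left_eq_self _ volume x]
    simp [ContinuousLinearMap.precompL_apply]
  have hint : ∀ v : ℂ, Integrable fun t => fderiv ℝ ρ (x - t) v • f t := by
    intro v
    have h1 : Continuous fun t => fderiv ℝ ρ (x - t) v :=
      ((hρ.continuous_fderiv (by norm_num)).comp (continuous_const.sub continuous_id)).clm_apply
        continuous_const
    refine hl.integrable_smul_left_of_hasCompactSupport h1 ?_
    exact (hc.fderiv_apply (𝕜 := ℝ) v).comp_homeomorph (Homeomorph.subLeft x)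
  have hφ : ContDiff ℝ ∞ fun t => ((ρ (x - t) : ℝ) : ℂ) :=
    Complex.ofRealCLM.contDiff.comp (hρ.comp (contDiff_const.sub contDiff_id))
  have hφc : HasCompactSupport fun t => ((ρ (x - t) : ℝ) : ℂ) :=
    (hc.comp_homeomorph (Homeomorph.subLeft x)).comp_left (g := fun r : ℝ => (r : ℂ)) (by simp)
  have hφd : ∀ t v, fderiv ℝ (fun t => ((ρ (x - t) : ℝ) : ℂ)) t v
      = -((fderiv ℝ ρ (x - t) v : ℝ) : ℂ) := by
    intro t v
    have h1 : HasFDerivAt (fun t => x - t) (-ContinuousLinearMap.id ℝ ℂ) t := by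
      simpa using (hasFDerivAt_id t).const_sub x
    have h2 : HasFDerivAt ρ (fderiv ℝ ρ (x - t)) (x - t) :=
      (hρ.differentiable (by norm_num) _).hasFDerivAt
    have h3 := (Complex.ofRealCLM.hasFDerivAt (x := ρ (x - t))).comp t (h2.comp t h1)
    have h4 : fderiv ℝ (fun t => ((ρ (x - t) : ℝ) : ℂ)) t = _ := h3.fderiv
    rw [h4]
    simp
  have h0 := hf _ hφ hφc
  have h1 : ∀ t, f t * (fderiv ℝ (fun t => ((ρ (x - t) : ℝ) : ℂ)) t 1
        + Complex.I * fderiv ℝ (fun t => ((ρ (x - t) : ℝ) : ℂ)) t Complex.I)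
      = -(fderiv ℝ ρ (x - t) 1 • f t + Complex.I * (fderiv ℝ ρ (x - t) Complex.I • f t)) := by
    intro t
    rw [hφd, hφd, Complex.real_smul, Complex.real_smul]
    ring
  simp_rw [h1] at h0
  rw [integral_neg, neg_eq_zero, integral_add (hint 1) ((hint _).const_mul _), integral_const_mul,
    ← hval, ← hval] at h0
  rw [smul_eq_mul]
  linear_combination (-Complex.I) * h0
    + fderiv ℝ (convolution ρ f (lsmul ℝ ℝ) volume) x Complex.I * Complex.I_mul_I

/-- Associativity and commutativity of convolution. In Weyl's lemma this exchanges the fixed entire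
mollifier with an approximate identity. -/
theorem convolution_left_comm {ρ φ : ℂ → ℝ} {f : ℂ → ℂ} (hρ : Continuous ρ)
    (hρc : HasCompactSupport ρ) (hφ : Continuous φ) (hφc : HasCompactSupport φ)
    (hf : LocallyIntegrable f) :
    convolution ρ (convolution φ f (lsmul ℝ ℝ) volume) (lsmul ℝ ℝ) volume
      = convolution φ (convolution ρ f (lsmul ℝ ℝ) volume) (lsmul ℝ ℝ) volume := by
  have assoc : ∀ {α β : ℂ → ℝ}, Continuous α → HasCompactSupport α → Continuous β →
      HasCompactSupport β →
      convolution (convolution α β (mul ℝ ℝ) volume) f (lsmul ℝ ℝ) volume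
        = convolution α (convolution β f (lsmul ℝ ℝ) volume) (lsmul ℝ ℝ) volume := by
    intro α β hα hαc hβ hβc
    ext x
    refine convolution_assoc _ _ _ _ (fun a b c => by simp [mul_smul]) hα.aestronglyMeasurable
      hβ.aestronglyMeasurable hf.aestronglyMeasurable
      (.of_forall fun y => hαc.convolutionExists_left _ hα hβ.locallyIntegrable y)
      (.of_forall fun y => hβc.norm.convolutionExists_left _ hβ.norm (fun z => (hf z).norm) y) ?_
    exact hαc.norm.convolutionExists_left _ hα.norm
      (hβc.norm.continuous_convolution_left _ hβ.norm fun z => (hf z).norm).locallyIntegrable x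
  rw [← assoc hρ hρc hφ hφc, ← assoc hφ hφc hρ hρc]
  congr 1
  rw [← convolution_flip]
  congr 1
  ext
  simp

/-- Weyl's lemma for the Cauchy–Riemann operator. -/
theorem IsWeaklyHolomorphic.exists_differentiable {f : ℂ → ℂ} (hf : IsWeaklyHolomorphic f)
    (hl : LocallyIntegrable f) : ∃ h : ℂ → ℂ, Differentiable ℂ h ∧ f =ᵐ[volume] h := by
  obtain ⟨ρ, hρ, hc, hmol⟩ := exists_entire_mollifier
  have hd := hf.differentiable_convolution hl hρ hc
  refine ⟨_, hd, ?_⟩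
  -- The ratio of outer to inner radius stays equal to `2`; almost everywhere convergence needs this
  -- ratio bounded.
  let φ : ℕ → ContDiffBump (0 : ℂ) := fun n =>
    ⟨1 / (n + 1), 2 * (1 / (n + 1)), by positivity, lt_mul_of_one_lt_left (by positivity)
      one_lt_two⟩
  have hφ : Tendsto (fun n => (φ n).rOut) atTop (𝓝 0) := by
    have := (tendsto_one_div_add_atTop_nhds_zero_nat (𝕜 := ℝ)).const_mul 2
    rwa [mul_zero] at this
  -- Since `φₙ * f` is entire, `φₙ * (ρ * f) = ρ * (φₙ * f) = φₙ * f`. The left side tends to `ρ *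
  -- f` everywhere and the right side to `f` almost everywhere.
  filter_upwards [ContDiffBump.ae_convolution_tendsto_right_of_locallyIntegrable (K := 2) hφ
    (.of_forall fun n => le_rfl) hl] with x hx
  refine tendsto_nhds_unique hx ?_
  have h2 := ContDiffBump.convolution_tendsto_right_of_continuous (μ := volume) hφ
    hd.continuous x
  refine h2.congr fun n => ?_
  have e := convolution_left_comm hρ.continuous hc (φ n).continuous_normed
    (φ n).hasCompactSupport_normed hl (φ := (φ n).normed volume)
  rw [← e, hmol _ (hf.differentiable_convolution hl (φ n).contDiff_normed
    (φ n).hasCompactSupport_normed)]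

/-- Local `L²` bounds control the values of entire functions. -/
theorem exists_norm_le_eLpNorm_of_differentiable : ∃ C R : ℝ, ∀ h : ℂ → ℂ, Differentiable ℂ h →
    ∀ z, ‖h z‖ ≤ C * (eLpNorm h 2 (volume.restrict (Metric.closedBall z R))).toReal := by
  obtain ⟨ρ, hρ, hc, hmol⟩ := exists_entire_mollifier
  obtain ⟨R, hR⟩ := hc.isCompact.isBounded.exists_norm_le
  -- Cauchy–Schwarz in the reproducing identity `h = ρ * h`, where `R` bounds the support of `ρ`.
  refine ⟨(eLpNorm ρ 2 volume).toReal, R, fun h hh z => ?_⟩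
  set μ := (volume : Measure ℂ).restrict (Metric.closedBall z R)
  have hval : h z = ∫ t, ρ (z - t) • h t ∂μ := by
    conv_lhs => rw [← hmol h hh, convolution_def]
    simp only [lsmul_apply]
    rw [← integral_sub_left_eq_self _ volume z]
    simp only [sub_sub_cancel]
    refine (setIntegral_eq_integral_of_forall_compl_eq_zero fun t ht => ?_).symm
    rw [image_eq_zero_of_notMem_tsupport (f := ρ), zero_smul]
    intro hm
    refine ht ?_
    rw [mem_closedBall_iff_norm, norm_sub_rev]
    exact hR _ hm
  have hm1 : Continuous fun t => ρ (z - t) := hρ.continuous.comp (continuous_const.sub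
    continuous_id)
  have hfin : eLpNorm h 2 μ ≠ ⊤ := by
    have : IsFiniteMeasure μ := isFiniteMeasure_restrict.2
      (isCompact_closedBall z R).measure_lt_top.ne
    obtain ⟨M, hM⟩ := (isCompact_closedBall z R).exists_bound_of_continuousOn
      hh.continuous.continuousOn
    exact (MemLp.of_bound hh.continuous.aestronglyMeasurable M
      ((ae_restrict_iff' Metric.isClosed_closedBall.measurableSet).2 (.of_forall hM))).2.ne
  have hρ2 : eLpNorm ρ 2 volume ≠ ⊤ := (hρ.continuous.memLp_of_hasCompactSupport hc).2.ne
  have hb : ‖h z‖ₑ ≤ eLpNorm ρ 2 volume * eLpNorm h 2 μ := by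
    rw [hval]
    calc ‖∫ t, ρ (z - t) • h t ∂μ‖ₑ
        ≤ ∫⁻ t, ‖ρ (z - t) • h t‖ₑ ∂μ := enorm_integral_le_lintegral_enorm _
      _ = eLpNorm ((fun t => ρ (z - t)) • h) 1 μ := by
          rw [eLpNorm_one_eq_lintegral_enorm]; rfl
      _ ≤ eLpNorm (fun t => ρ (z - t)) 2 μ * eLpNorm h 2 μ :=
          eLpNorm_smul_le_mul_eLpNorm hh.continuous.aestronglyMeasurable hm1.aestronglyMeasurable
      _ ≤ eLpNorm (fun t => ρ (z - t)) 2 volume * eLpNorm h 2 μ := by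
          gcongr
          exact Measure.restrict_le_self
      _ = eLpNorm ρ 2 volume * eLpNorm h 2 μ := by
          rw [← eLpNorm_comp_measurePreserving (g := ρ) (f := fun t => z - t)
            hρ.continuous.aestronglyMeasurable (measurePreserving_sub_left volume z)]
          rfl
  have := ENNReal.toReal_mono (ENNReal.mul_ne_top hρ2 hfin) hb
  rwa [toReal_enorm, ENNReal.toReal_mul] at this

/-- A square integrable entire function vanishes. -/
theorem eq_zero_of_differentiable_of_memLp {h : ℂ → ℂ} (hh : Differentiable ℂ h)
    (hm : MemLp h 2 (volume : Measure ℂ)) : h = 0 := by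
  obtain ⟨C, R, hC⟩ := exists_norm_le_eLpNorm_of_differentiable
  have hbd : Bornology.IsBounded (range h) := by
    refine isBounded_iff_forall_norm_le.2 ⟨|C| * (eLpNorm h 2 volume).toReal, ?_⟩
    rintro _ ⟨z, rfl⟩
    refine (hC h hh z).trans (mul_le_mul (le_abs_self C) ?_ ENNReal.toReal_nonneg (abs_nonneg C))
    exact ENNReal.toReal_mono hm.2.ne (eLpNorm_mono_measure _ Measure.restrict_le_self)
  -- Liouville's theorem; the plane has infinite measure, so the only square integrable constant is
  -- `0`.
  obtain ⟨c, rfl⟩ := hh.exists_eq_const_of_bounded hbd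
  have hc := (memLp_const_iff (μ := (volume : Measure ℂ)) (p := 2) (c := c) (by norm_num)
    (by norm_num)).1 hm
  rcases hc with hc | hc
  · ext; simp [hc]
  · simp at hc

/-! ### The lowest Landau level consists of entire functions -/

theorem contDiff_transposePi (b : ℝ) (j : Fin 2) {φ : ℂ → ℂ} (h : ContDiff ℝ ∞ φ) :
    ContDiff ℝ ∞ (transposePi b j φ) := by
  have hA : ContDiff ℝ ∞ fun x => ((vecPot b x j : ℝ) : ℂ) := by
    refine Complex.ofRealCLM.contDiff.comp ?_
    fin_cases j
    · exact contDiff_const.mul Complex.imCLM.contDiff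
    · exact contDiff_const.mul Complex.reCLM.contDiff
  have h1 : ContDiff ℝ ∞ fun x => fderiv ℝ φ x (dir j) :=
    (h.fderiv_right (m := ∞) (by simp)).clm_apply contDiff_const
  exact (contDiff_const.mul h1).sub (hA.mul h)

/-- The commutator of the two components of the magnetic gradient is the magnetic field. -/
theorem transposePi_comm (b : ℝ) {φ : ℂ → ℂ} (h : ContDiff ℝ ∞ φ) (x : ℂ) :
    transposePi b 1 (transposePi b 0 φ) x - transposePi b 0 (transposePi b 1 φ) x
      = Complex.I * b * φ x := by
  have hsymm : fderiv ℝ (fderiv ℝ φ) x 1 Complex.I = fderiv ℝ (fderiv ℝ φ) x Complex.I 1 :=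
    (h.contDiffAt (x := x)).isSymmSndFDerivAt
      (by rw [minSmoothness_of_isRCLikeNormedField]; exact WithTop.coe_le_coe.2 (le_top : (2 : ℕ∞) ≤ ⊤)) 1 Complex.I
  have hφ : HasFDerivAt φ (fderiv ℝ φ x) x := (h.differentiable (by simp) x).hasFDerivAt
  have hφ2 : HasFDerivAt (fderiv ℝ φ) (fderiv ℝ (fderiv ℝ φ) x) x :=
    ((h.fderiv_right (m := ∞) (by simp)).differentiable (by simp) x).hasFDerivAt
  have hd : ∀ v, HasFDerivAt (fun y => Complex.I * fderiv ℝ φ y v)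
      (Complex.I • (fderiv ℝ (fderiv ℝ φ) x).flip v) x := fun v => by
    have := (hφ2.clm_apply (hasFDerivAt_const v x)).const_mul Complex.I
    simpa using this
  have him : HasFDerivAt (fun y : ℂ => (((-(b / 2) * y.im : ℝ)) : ℂ))
      (Complex.ofRealCLM.comp (-(b / 2) • Complex.imCLM)) x :=
    (Complex.ofRealCLM.comp (-(b / 2) • Complex.imCLM)).hasFDerivAt
  have hre : HasFDerivAt (fun y : ℂ => (((b / 2 * y.re : ℝ)) : ℂ))
      (Complex.ofRealCLM.comp ((b / 2) • Complex.reCLM)) x :=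
    (Complex.ofRealCLM.comp ((b / 2) • Complex.reCLM)).hasFDerivAt
  have h0 : fderiv ℝ (transposePi b 0 φ) x = _ := ((hd 1).sub (him.mul hφ)).fderiv
  have h1 : fderiv ℝ (transposePi b 1 φ) x = _ := ((hd Complex.I).sub (hre.mul hφ)).fderiv
  have hT : ∀ j ψ, transposePi b j ψ x
      = Complex.I * fderiv ℝ ψ x (dir j) - (vecPot b x j : ℂ) * ψ x := fun _ _ => rfl
  rw [hT 1 (transposePi b 0 φ), hT 0 (transposePi b 1 φ), h0, h1]
  simp [dir, vecPot, transposePi, hsymm]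
  ring

/-! ### Removing the potential by a Gaussian factor -/

/-- The Gaussian `exp (c |x|²)`. -/
def gaussian (c : ℝ) (x : ℂ) : ℂ := ((Real.exp (c * ‖x‖ ^ 2) : ℝ) : ℂ)

theorem contDiff_gaussian (c : ℝ) : ContDiff ℝ ∞ (gaussian c) :=
  Complex.ofRealCLM.contDiff.comp
    (Real.contDiff_exp.comp (contDiff_const.mul (contDiff_norm_sq ℝ)))

theorem gaussian_neg_mul (c : ℝ) (x : ℂ) : gaussian (-c) x * gaussian c x = 1 := by
  rw [gaussian, gaussian, ← Complex.ofReal_mul, ← Real.exp_add]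
  simp

theorem fderiv_gaussian_mul (c : ℝ) {ψ : ℂ → ℂ} (h : ContDiff ℝ ∞ ψ) (x v : ℂ) :
    fderiv ℝ (fun y => gaussian c y * ψ y) x v
      = gaussian c x * (fderiv ℝ ψ x v + 2 * c * (x.re * v.re + x.im * v.im : ℝ) * ψ x) := by
  have hψ : HasFDerivAt ψ (fderiv ℝ ψ x) x := (h.differentiable (by simp) x).hasFDerivAt
  have hn := ((hasStrictFDerivAt_norm_sq x).hasFDerivAt.const_mul c).exp
  have hg : HasFDerivAt (gaussian c) _ x := Complex.ofRealCLM.hasFDerivAt.comp x hn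
  have e : fderiv ℝ (fun y => gaussian c y * ψ y) x = _ := (hg.mul hψ).fderiv
  rw [e]
  simp [gaussian, Complex.inner]
  ring

/-- With `z = x₁ + i x₂`, the growing Gaussian `G` satisfies `(∂₁ + i∂₂)G = (b/2) z G`, and this
cancels `A₁ + iA₂ = i (b/2) z`. -/
theorem transposePi_gaussian_mul_add (b : ℝ) {ψ : ℂ → ℂ} (h : ContDiff ℝ ∞ ψ) (x : ℂ) :
    transposePi b 0 (fun y => gaussian (b / 4) y * ψ y) x
        + Complex.I * transposePi b 1 (fun y => gaussian (b / 4) y * ψ y) x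
      = Complex.I * (gaussian (b / 4) x *
        (fderiv ℝ ψ x 1 + Complex.I * fderiv ℝ ψ x Complex.I)) := by
  simp [transposePi, fderiv_gaussian_mul _ h, dir, vecPot]
  linear_combination (gaussian (b / 4) x * ψ x * b / 2 * x.im) * Complex.I_mul_I

/-- The mirror cancellation, with `A₁ - iA₂ = -i (b/2) z̄`, requires the decaying Gaussian. Its
boundedness later keeps the product in `L²`. -/
theorem transposePi_gaussian_mul_sub (b : ℝ) {ψ : ℂ → ℂ} (h : ContDiff ℝ ∞ ψ) (x : ℂ) :
    transposePi b 0 (fun y => gaussian (-(b / 4)) y * ψ y) x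
        - Complex.I * transposePi b 1 (fun y => gaussian (-(b / 4)) y * ψ y) x
      = Complex.I * (gaussian (-(b / 4)) x *
        (fderiv ℝ ψ x 1 - Complex.I * fderiv ℝ ψ x Complex.I)) := by
  simp [transposePi, fderiv_gaussian_mul _ h, dir, vecPot]
  linear_combination (gaussian (-(b / 4)) x * ψ x * b / 2 * x.im) * Complex.I_mul_I

/-! ### The eigenvalue equation in weak form -/

theorem mem_landauSpace_iff {b : ℝ} {q : ℕ} {u : L2} : u ∈ landauSpace b q ↔
    ∃ w : H1A b, w.fn = u ∧ ∀ v : H1A b, energy v w = landauLevel b q * inner ℂ v.fn u := by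
  have hg : u ∈ landauSpace b q ↔
      (u, (landauLevel b q : ℂ) • u) ∈ (landauHamiltonian b).graph := by
    rw [LinearPMap.mem_graph_iff]
    constructor
    · rintro ⟨h, e⟩
      exact ⟨⟨u, h⟩, rfl, e⟩
    · rintro ⟨⟨y, h⟩, rfl, e⟩
      exact ⟨h, e⟩
  rw [hg, graph_landauHamiltonian]
  refine exists_congr fun w => and_congr_right fun _ => forall_congr' fun v => ?_
  rw [inner_smul_right]

/-- A test function as an element of `H¹_A(ℝ²)`, with its magnetic gradient. -/
theorem exists_H1A_grad_of_test (b : ℝ) {ψ : ℂ → ℂ} (hψ : ContDiff ℝ ∞ ψ)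
    (hc : HasCompactSupport ψ) : ∃ w : H1A b, (w.fn : ℂ → ℂ) =ᵐ[volume] ψ ∧
      ∀ j, (w.grad j : ℂ → ℂ) =ᵐ[volume]
        fun x => -Complex.I * fderiv ℝ ψ x (dir j) - (vecPot b x j : ℂ) * ψ x := by
  obtain ⟨w, hw⟩ := exists_H1A_of_test b hψ hc
  refine ⟨w, hw, fun j => ?_⟩
  have hm : MemLp (fun x => -Complex.I * fderiv ℝ ψ x (dir j) - (vecPot b x j : ℂ) * ψ x) 2
      (volume : Measure ℂ) := by
    refine memLp_of_test ?_ ?_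
    · exact (continuous_const.mul ((hψ.continuous_fderiv (by simp)).clm_apply
        continuous_const)).sub
        ((Complex.continuous_ofReal.comp (continuous_vecPot b j)).mul hψ.continuous)
    · exact ((hc.fderiv_apply (𝕜 := ℝ) (dir j)).mul_left (f := fun _ => -Complex.I)).sub
        (hc.mul_left (f := fun x => (vecPot b x j : ℂ)))
  have hz : w.grad j + (-1 : ℂ) • hm.toLp = 0 := eq_zero_of_test fun φ hφ hφc => by
    rw [integral_add_mul _ _ hφ.continuous hφc, integral_smul_mul]
    have e1 : ∫ x, w.grad j x * φ x = ∫ x, w.fn x * transposePi b j φ x := w.2 j φ hφ hφc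
    have e2 : ∫ x, w.fn x * transposePi b j φ x = ∫ x, ψ x * transposePi b j φ x :=
      integral_congr_ae (by filter_upwards [hw] with x hx; rw [hx])
    have e3 : ∫ x, (hm.toLp : L2) x * φ x
        = ∫ x, (-Complex.I * fderiv ℝ ψ x (dir j) - (vecPot b x j : ℂ) * ψ x) * φ x :=
      integral_congr_ae (by filter_upwards [hm.coeFn_toLp] with x hx; rw [hx])
    rw [e1, e2, e3, integral_pi_mul_test b j hψ hc hφ]
    ring
  rw [neg_one_smul, ← sub_eq_add_neg, sub_eq_zero] at hz
  rw [hz]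
  exact hm.coeFn_toLp

/-- The eigenvalue equation in the sense of distributions. -/
theorem sum_integral_grad_mul_transposePi {b l : ℝ} {w : H1A b}
    (hw : ∀ v : H1A b, energy v w = l * inner ℂ v.fn w.fn) {φ : ℂ → ℂ} (hφ : ContDiff ℝ ∞ φ)
    (hc : HasCompactSupport φ) :
    ∑ j, ∫ x, w.grad j x * transposePi b j φ x = l * ∫ x, w.fn x * φ x := by
  -- The energy is conjugate-linear in its first argument, so the conjugate of `φ` is the element to
  -- test with.
  have hψ : ContDiff ℝ ∞ fun x => (starRingEnd ℂ) (φ x) := Complex.conjCLE.contDiff.comp hφ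
  have hψc : HasCompactSupport fun x => (starRingEnd ℂ) (φ x) :=
    hc.comp_left (g := fun z : ℂ => (starRingEnd ℂ) z) (by simp)
  obtain ⟨v, hv, hvg⟩ := exists_H1A_grad_of_test b hψ hψc
  have h := hw v
  rw [energy, L2.inner_def] at h
  have hd : ∀ x e, (starRingEnd ℂ) (fderiv ℝ (fun x => (starRingEnd ℂ) (φ x)) x e)
      = fderiv ℝ φ x e := by
    intro x e
    have h1 : HasFDerivAt (fun x => (starRingEnd ℂ) (φ x)) _ x :=
      (Complex.conjCLE : ℂ →L[ℝ] ℂ).hasFDerivAt.comp x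
        (hφ.differentiable (by simp) x).hasFDerivAt
    rw [h1.fderiv]
    simp
  have e1 : ∀ j, inner ℂ (v.grad j) (w.grad j) = ∫ x, w.grad j x * transposePi b j φ x := by
    intro j
    rw [L2.inner_def]
    refine integral_congr_ae ?_
    filter_upwards [hvg j] with x hx
    rw [hx, RCLike.inner_apply, map_sub, map_mul, map_mul, hd]
    simp [transposePi]
  have e2 : ∫ x, inner ℂ (v.fn x) (w.fn x) = ∫ x, w.fn x * φ x := by
    refine integral_congr_ae ?_
    filter_upwards [hv] with x hx
    rw [hx, RCLike.inner_apply]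
    simp
  simp_rw [e1, e2] at h
  exact h

theorem locallyIntegrable_gaussian_mul (c : ℝ) {u : ℂ → ℂ} (hu : MemLp u 2 volume) :
    LocallyIntegrable fun x => gaussian c x * u x := by
  have := (hu.locallyIntegrable (by norm_num)).continuous_mul (contDiff_gaussian c).continuous
  exact this

/-- The creation-annihilation identity `(Π₁ - i Π₂)(Π₁ + i Π₂) u = 0` in the sense of
distributions, in the gauge where it is the conjugate Cauchy–Riemann equation. -/
theorem isWeaklyHolomorphic_conj_grad {b : ℝ} {w : H1A b}
    (hw : ∀ v : H1A b, energy v w = b * inner ℂ v.fn w.fn) :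
    IsWeaklyHolomorphic fun x => gaussian (-(b / 4)) x *
      (starRingEnd ℂ) (w.grad 0 x + Complex.I * w.grad 1 x) := by
  intro ψ hψ hψc
  -- The transposed operator yields `∂₁ - i∂₂`. Testing with the conjugate of `ψ` and conjugating
  -- the resulting integral turns this into `∂₁ + i∂₂`.
  set χ : ℂ → ℂ := fun x => (starRingEnd ℂ) (ψ x)
  have hχ : ContDiff ℝ ∞ χ := Complex.conjCLE.contDiff.comp hψ
  have hχc : HasCompactSupport χ :=
    hψc.comp_left (g := fun z : ℂ => (starRingEnd ℂ) z) (by simp)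
  have hd : ∀ x e, fderiv ℝ χ x e = (starRingEnd ℂ) (fderiv ℝ ψ x e) := by
    intro x e
    have h1 : HasFDerivAt χ _ x := (Complex.conjCLE : ℂ →L[ℝ] ℂ).hasFDerivAt.comp x
        (hψ.differentiable (by simp) x).hasFDerivAt
    rw [h1.fderiv]
    simp
  set φ : ℂ → ℂ := fun x => gaussian (-(b / 4)) x * χ x
  have hφ : ContDiff ℝ ∞ φ := (contDiff_gaussian _).mul hχ
  have hφc : HasCompactSupport φ := hχc.mul_left
  have hT : ∀ j, ContDiff ℝ ∞ (transposePi b j φ) := fun j => contDiff_transposePi b j hφ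
  have hTc : ∀ j, HasCompactSupport (transposePi b j φ) := fun j =>
    hasCompactSupport_transposePi b j hφc
  have hI : ∀ j k, Integrable fun x => w.grad j x * transposePi b k φ x := fun j k =>
    integrable_mul_test _ (hT k).continuous (hTc k)
  have h1 := sum_integral_grad_mul_transposePi hw hφ hφc
  rw [Fin.sum_univ_two] at h1
  -- The cross terms leave only the commutator; after multiplication by `i` they contribute `-b ∫ u
  -- φ`, which cancels the eigenvalue term in `h1`.
  have h2 : ∫ x, w.grad 1 x * transposePi b 0 φ x - w.grad 0 x * transposePi b 1 φ x
      = Complex.I * b * ∫ x, w.fn x * φ x := by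
    have e0 : ∫ x, w.grad 1 x * transposePi b 0 φ x
        = ∫ x, w.fn x * transposePi b 1 (transposePi b 0 φ) x := w.2 1 _ (hT 0) (hTc 0)
    have e1 : ∫ x, w.grad 0 x * transposePi b 1 φ x
        = ∫ x, w.fn x * transposePi b 0 (transposePi b 1 φ) x := w.2 0 _ (hT 1) (hTc 1)
    rw [integral_sub (hI 1 0) (hI 0 1), e0, e1, ← integral_sub
      (integrable_mul_test _ (contDiff_transposePi b 1 (hT 0)).continuous
        (hasCompactSupport_transposePi b 1 (hTc 0)))
      (integrable_mul_test _ (contDiff_transposePi b 0 (hT 1)).continuous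
        (hasCompactSupport_transposePi b 0 (hTc 1))), ← integral_const_mul]
    refine integral_congr_ae (.of_forall fun x => ?_)
    simp only
    rw [← mul_sub, transposePi_comm b hφ]
    ring
  have h3 : ∫ x, (w.grad 0 x + Complex.I * w.grad 1 x) *
      (transposePi b 0 φ x - Complex.I * transposePi b 1 φ x) = 0 := by
    have e : ∀ x, (w.grad 0 x + Complex.I * w.grad 1 x) *
        (transposePi b 0 φ x - Complex.I * transposePi b 1 φ x)
        = (w.grad 0 x * transposePi b 0 φ x + w.grad 1 x * transposePi b 1 φ x)
          + Complex.I * (w.grad 1 x * transposePi b 0 φ x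
            - w.grad 0 x * transposePi b 1 φ x) := fun x => by
      linear_combination (-(w.grad 1 x * transposePi b 1 φ x)) * Complex.I_mul_I
    simp_rw [e]
    have hs : Integrable fun x => w.grad 0 x * transposePi b 0 φ x
        + w.grad 1 x * transposePi b 1 φ x := (hI 0 0).add (hI 1 1)
    have ht : Integrable fun x => Complex.I * (w.grad 1 x * transposePi b 0 φ x
        - w.grad 0 x * transposePi b 1 φ x) := ((hI 1 0).sub (hI 0 1)).const_mul _
    rw [integral_add hs ht, integral_const_mul, h2, integral_add (hI 0 0) (hI 1 1), h1]
    linear_combination (b * ∫ x, w.fn x * φ x) * Complex.I_mul_I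
  have h4 := congrArg (starRingEnd ℂ) h3
  rw [map_zero, ← integral_conj] at h4
  have h5 : ∀ x, (starRingEnd ℂ) ((w.grad 0 x + Complex.I * w.grad 1 x) *
      (transposePi b 0 φ x - Complex.I * transposePi b 1 φ x))
      = -Complex.I * (gaussian (-(b / 4)) x *
        (starRingEnd ℂ) (w.grad 0 x + Complex.I * w.grad 1 x) *
          (fderiv ℝ ψ x 1 + Complex.I * fderiv ℝ ψ x Complex.I)) := fun x => by
    rw [transposePi_gaussian_mul_sub b hχ, hd, hd]
    have hg : (starRingEnd ℂ) (gaussian (-(b / 4)) x) = gaussian (-(b / 4)) x :=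
      Complex.conj_ofReal _
    simp only [map_mul, map_sub, Complex.conj_conj, hg, Complex.conj_I]
    ring
  simp_rw [h5] at h4
  rw [integral_const_mul] at h4
  exact (mul_eq_zero.1 h4).resolve_left (by simp)

/-- Functions of the lowest Landau level are annihilated by `Π₁ + i Π₂`. -/
theorem grad_add_I_mul_grad_ae_eq_zero {b : ℝ} (hb : 0 < b) {w : H1A b}
    (hw : ∀ v : H1A b, energy v w = b * inner ℂ v.fn w.fn) :
    ∀ᵐ x, w.grad 0 x + Complex.I * w.grad 1 x = 0 := by
  have hm : MemLp (fun x => w.grad 0 x + Complex.I * w.grad 1 x) 2 volume :=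
    (Lp.memLp (w.grad 0)).add ((Lp.memLp (w.grad 1)).const_mul Complex.I)
  have hmc : MemLp (fun x => (starRingEnd ℂ) (w.grad 0 x + Complex.I * w.grad 1 x)) 2 volume :=
    hm.star
  obtain ⟨h, hh, he⟩ := (isWeaklyHolomorphic_conj_grad hw).exists_differentiable
    (locallyIntegrable_gaussian_mul _ hmc)
  have hle : ∀ x, ‖gaussian (-(b / 4)) x‖ ≤ 1 := fun x => by
    rw [gaussian, Complex.norm_real, Real.norm_of_nonneg (Real.exp_pos _).le, Real.exp_le_one_iff]
    have : 0 ≤ b / 4 * ‖x‖ ^ 2 := by positivity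
    linarith
  have hmem : MemLp h 2 volume := by
    refine hm.of_le hh.continuous.aestronglyMeasurable ?_
    filter_upwards [he] with x hx
    rw [← hx, norm_mul, RCLike.norm_conj]
    exact mul_le_of_le_one_left (norm_nonneg _) (hle x)
  rw [eq_zero_of_differentiable_of_memLp hh hmem] at he
  filter_upwards [he] with x hx
  have := (mul_eq_zero.1 hx).resolve_left fun h0 => by
    have := gaussian_neg_mul (b / 4) x
    simp [h0] at this
  exact (map_eq_zero (starRingEnd ℂ)).1 this

/-- Functions of the lowest Landau level are entire functions times a Gaussian. -/
theorem exists_differentiable_of_mem_landauSpace {b : ℝ} (hb : 0 < b) {u : L2}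
    (hu : u ∈ landauSpace b 0) : ∃ h : ℂ → ℂ, Differentiable ℂ h ∧
      (u : ℂ → ℂ) =ᵐ[volume] fun x => gaussian (-(b / 4)) x * h x := by
  obtain ⟨w, rfl, hw⟩ := mem_landauSpace_iff.1 hu
  have h0 := grad_add_I_mul_grad_ae_eq_zero hb (w := w) (by simpa [landauLevel] using hw)
  -- The growth of the Gaussian is harmless here, since Weyl's lemma needs only local integrability.
  have hweak : IsWeaklyHolomorphic fun x => gaussian (b / 4) x * w.fn x := by
    intro ψ hψ hψc
    set φ : ℂ → ℂ := fun x => gaussian (b / 4) x * ψ x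
    have hφ : ContDiff ℝ ∞ φ := (contDiff_gaussian _).mul hψ
    have hφc : HasCompactSupport φ := hψc.mul_left
    have e : ∀ j : Fin 2, ∫ x, w.grad j x * φ x = ∫ x, w.fn x * transposePi b j φ x := fun j =>
      w.2 j φ hφ hφc
    have hI : ∀ j, Integrable fun x => w.fn x * transposePi b j φ x := fun j =>
      integrable_mul_test _ (continuous_transposePi b j hφ) (hasCompactSupport_transposePi b j hφc)
    have hG : ∀ j, Integrable fun x => w.grad j x * φ x := fun j =>
      integrable_mul_test _ hφ.continuous hφc
    have h1 : ∫ x, w.fn x * (transposePi b 0 φ x + Complex.I * transposePi b 1 φ x) = 0 := by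
      have e1 : ∀ x, w.fn x * (transposePi b 0 φ x + Complex.I * transposePi b 1 φ x)
          = w.fn x * transposePi b 0 φ x + Complex.I * (w.fn x * transposePi b 1 φ x) :=
        fun x => by ring
      simp_rw [e1]
      rw [integral_add (hI 0) ((hI 1).const_mul _), integral_const_mul, ← e, ← e,
        ← integral_const_mul, ← integral_add (hG 0) ((hG 1).const_mul _)]
      refine integral_eq_zero_of_ae ?_
      filter_upwards [h0] with x hx
      rw [Pi.zero_apply]
      linear_combination φ x * hx
    have h2 : ∀ x, w.fn x * (transposePi b 0 φ x + Complex.I * transposePi b 1 φ x)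
        = Complex.I * (gaussian (b / 4) x * w.fn x *
          (fderiv ℝ ψ x 1 + Complex.I * fderiv ℝ ψ x Complex.I)) := fun x => by
      rw [transposePi_gaussian_mul_add b hψ]
      ring
    simp_rw [h2] at h1
    rw [integral_const_mul] at h1
    exact (mul_eq_zero.1 h1).resolve_left Complex.I_ne_zero
  obtain ⟨h, hh, he⟩ := hweak.exists_differentiable
    (locallyIntegrable_gaussian_mul _ (Lp.memLp w.fn))
  refine ⟨h, hh, ?_⟩
  filter_upwards [he] with x hx
  rw [← hx, ← mul_assoc, gaussian_neg_mul, one_mul]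

/-! ### Completeness of the eigenspaces -/

theorem continuous_integral_mul_test {φ : ℂ → ℂ} (h : Continuous φ) (hc : HasCompactSupport φ) :
    Continuous fun u : L2 => ∫ x, u x * φ x := by
  have hm : MemLp (fun x => (starRingEnd ℂ) (φ x)) 2 (volume : Measure ℂ) :=
    memLp_of_test (Complex.continuous_conj.comp h)
      (hc.comp_left (g := fun z : ℂ => (starRingEnd ℂ) z) (by simp))
  have e : (fun u : L2 => ∫ x, u x * φ x) = fun u => inner ℂ (hm.toLp : L2) u := by
    ext u
    rw [L2.inner_def]
    refine integral_congr_ae ?_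
    filter_upwards [hm.coeFn_toLp] with x hx
    rw [hx, RCLike.inner_apply]
    simp
  rw [e]
  exact continuous_const.inner continuous_id

/-- For a fixed test function both sides of the weak derivative identity are continuous in `L²`, so
`magneticSobolev b` is an intersection of closed sets. -/
instance completeSpace_H1A (b : ℝ) : CompleteSpace (H1A b) := by
  have hcl : IsClosed (magneticSobolev b : Set (PiLp 2 fun _ : Fin 3 => L2)) := by
    have e : (magneticSobolev b : Set (PiLp 2 fun _ : Fin 3 => L2))
        = ⋂ (j : Fin 2) (φ : ℂ → ℂ) (_ : ContDiff ℝ ∞ φ) (_ : HasCompactSupport φ),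
          {w | ∫ x, w j.succ x * φ x = ∫ x, w 0 x * transposePi b j φ x} := by
      ext w
      simp only [mem_iInter]
      rfl
    rw [e]
    refine isClosed_iInter fun j => isClosed_iInter fun φ => isClosed_iInter fun hφ =>
      isClosed_iInter fun hc => isClosed_eq ?_ ?_
    · exact (continuous_integral_mul_test hφ.continuous hc).comp (PiLp.continuous_apply 2 _ _)
    · exact (continuous_integral_mul_test (continuous_transposePi b j hφ)
        (hasCompactSupport_transposePi b j hc)).comp (PiLp.continuous_apply 2 _ _)
  exact hcl.isComplete.completeSpace_coe

/-- The component of an element of `H¹_A(ℝ²)` as a bounded linear map. -/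
def H1A.projL (b : ℝ) (i : Fin 3) : H1A b →L[ℂ] L2 :=
  (PiLp.proj 2 (fun _ : Fin 3 => L2) i).comp (magneticSobolev b).subtypeL

/-- The elements of `H¹_A(ℝ²)` which solve the eigenvalue equation in the form sense. -/
def formEigenspace (b l : ℝ) : Submodule ℂ (H1A b) :=
  ⨅ v : H1A b, LinearMap.ker ((∑ j : Fin 2, (innerSL ℂ (v.grad j)).comp (H1A.projL b j.succ)
    - (l : ℂ) • (innerSL ℂ v.fn).comp (H1A.projL b 0)).toLinearMap)

theorem mem_formEigenspace {b l : ℝ} {w : H1A b} : w ∈ formEigenspace b l ↔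
    ∀ v : H1A b, energy v w = l * inner ℂ v.fn w.fn := by
  rw [formEigenspace, Submodule.mem_iInf]
  refine forall_congr' fun v => ?_
  rw [LinearMap.mem_ker, ← sub_eq_zero (a := energy v w)]
  simp [energy, H1A.projL, H1A.grad, H1A.fn]

theorem isClosed_formEigenspace (b l : ℝ) : IsClosed (formEigenspace b l : Set (H1A b)) := by
  rw [formEigenspace, Submodule.coe_iInf]
  exact isClosed_iInter fun v => ContinuousLinearMap.isClosed_ker _

/-- Test the eigenvalue equation with `w` itself. On an eigenspace the `H¹_A` and `L²` norms are
thus proportional. -/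
theorem norm_sq_of_mem_formEigenspace {b l : ℝ} {w : H1A b} (hw : w ∈ formEigenspace b l) :
    ‖w‖ ^ 2 = (1 + l) * ‖w.fn‖ ^ 2 := by
  have h := mem_formEigenspace.1 hw w
  rw [energy, Fin.sum_univ_two, inner_self_eq_norm_sq_to_K, inner_self_eq_norm_sq_to_K,
    inner_self_eq_norm_sq_to_K] at h
  have h' : ‖w.grad 0‖ ^ 2 + ‖w.grad 1‖ ^ 2 = l * ‖w.fn‖ ^ 2 := by
    apply Complex.ofReal_injective
    push_cast
    exact h
  have hn : ‖w‖ ^ 2 = ‖w.fn‖ ^ 2 + (‖w.grad 0‖ ^ 2 + ‖w.grad 1‖ ^ 2) := by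
    have := PiLp.norm_sq_eq_of_L2 (fun _ : Fin 3 => L2) (w : PiLp 2 fun _ : Fin 3 => L2)
    rw [Fin.sum_univ_three, add_assoc] at this
    exact this
  rw [hn, h']
  ring

/-- The eigenspace is the image of the closed subspace `formEigenspace` under a map that is bounded
below there. Completeness is needed for the Riesz representation and the adjoint in
`exists_isToeplitz`. -/
instance completeSpace_landauSpace (b : ℝ) (q : ℕ) : CompleteSpace (landauSpace b q) := by
  set l := landauLevel b q
  have : CompleteSpace (formEigenspace b l) :=
    (isClosed_formEigenspace b l).isComplete.completeSpace_coe
  let F : formEigenspace b l →L[ℂ] L2 := (H1A.projL b 0).comp (formEigenspace b l).subtypeL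
  have hF : AntilipschitzWith (Real.toNNReal (Real.sqrt (1 + l))) F := by
    refine AddMonoidHomClass.antilipschitz_of_bound F fun w => ?_
    have h := norm_sq_of_mem_formEigenspace w.2
    rw [Real.coe_toNNReal _ (Real.sqrt_nonneg _)]
    change ‖(w : H1A b)‖ ≤ Real.sqrt (1 + l) * ‖H1A.fn (w : H1A b)‖
    rw [← Real.sqrt_sq (norm_nonneg (w : H1A b)), h, Real.sqrt_mul' _ (sq_nonneg _),
      Real.sqrt_sq (norm_nonneg _)]
  have e : (landauSpace b q : Set L2) = range F := by
    ext u
    rw [SetLike.mem_coe, mem_landauSpace_iff]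
    constructor
    · rintro ⟨w, rfl, hw⟩
      exact ⟨⟨w, mem_formEigenspace.2 hw⟩, rfl⟩
    · rintro ⟨w, rfl⟩
      exact ⟨w, rfl, mem_formEigenspace.1 w.2⟩
  have hc := hF.isComplete_range F.uniformContinuous
  rw [← e] at hc
  exact hc.completeSpace_coe

/-! ### Traces of functions of the lowest Landau level -/

/-- The trace of a continuous function of `H¹_A(ℝ²)` is its restriction. -/
theorem trace_ae_eq {b : ℝ} (Γ : JordanCurve) (w : H1A b) {f : ℂ → ℂ} (hf : Continuous f)
    (h : (w.fn : ℂ → ℂ) =ᵐ[volume] f) : (trace b Γ w.fn : ℂ → ℂ) =ᵐ[Γ.arcLength] f := by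
  have hm := Γ.memLp_of_continuous hf
  have hg : ((w, hm.toLp) : H1A b × Γ.L2) ∈ (restriction b Γ).graph := by
    rw [graph_restriction]
    exact ⟨f, hf, h, hm.coeFn_toLp⟩
  have hg' : ((w, hm.toLp) : H1A b × Γ.L2) ∈ (traceOp b Γ).graph :=
    LinearPMap.le_graph_of_le (restriction b Γ).le_closure hg
  obtain ⟨y, hy, hyt⟩ := (LinearPMap.mem_graph_iff _).1 hg'
  have hex : ∃ w' : (traceOp b Γ).domain, H1A.fn (w' : H1A b) = w.fn := ⟨y, congrArg H1A.fn hy⟩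
  -- The choice made in `trace` is harmless: an element of `H¹_A` is determined by its function.
  have hy' : hex.choose = y := Subtype.ext (H1A.fn_injective (hex.choose_spec.trans
    (congrArg H1A.fn hy).symm))
  rw [trace, dif_pos hex, hy', hyt]
  exact hm.coeFn_toLp

/-- The entire function `h` such that `u = exp (-b |x|² / 4) h`. -/
def entirePart {b : ℝ} (hb : 0 < b) (u : landauSpace b 0) : ℂ → ℂ :=
  (exists_differentiable_of_mem_landauSpace hb u.2).choose

theorem differentiable_entirePart {b : ℝ} (hb : 0 < b) (u : landauSpace b 0) :
    Differentiable ℂ (entirePart hb u) :=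
  (exists_differentiable_of_mem_landauSpace hb u.2).choose_spec.1

/-- The continuous representative of a function of the lowest Landau level. -/
def contRep {b : ℝ} (hb : 0 < b) (u : landauSpace b 0) (x : ℂ) : ℂ :=
  gaussian (-(b / 4)) x * entirePart hb u x

theorem continuous_contRep {b : ℝ} (hb : 0 < b) (u : landauSpace b 0) :
    Continuous (contRep hb u) :=
  (contDiff_gaussian _).continuous.mul (differentiable_entirePart hb u).continuous

theorem coeFn_ae_eq_contRep {b : ℝ} (hb : 0 < b) (u : landauSpace b 0) :
    ((u : L2) : ℂ → ℂ) =ᵐ[volume] contRep hb u :=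
  (exists_differentiable_of_mem_landauSpace hb u.2).choose_spec.2

/-- The entire parts are chosen separately for each function, so additivity comes from uniqueness:
continuous functions equal almost everywhere are equal. -/
theorem contRep_add {b : ℝ} (hb : 0 < b) (u v : landauSpace b 0) (x : ℂ) :
    contRep hb (u + v) x = contRep hb u x + contRep hb v x := by
  refine congrFun (((continuous_contRep hb (u + v)).ae_eq_iff_eq volume
    ((continuous_contRep hb u).add (continuous_contRep hb v))).1 ?_) x
  refine (coeFn_ae_eq_contRep hb (u + v)).symm.trans ?_
  exact (Lp.coeFn_add (u : L2) v).trans ((coeFn_ae_eq_contRep hb u).add (coeFn_ae_eq_contRep hb v))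

theorem contRep_smul {b : ℝ} (hb : 0 < b) (c : ℂ) (u : landauSpace b 0) (x : ℂ) :
    contRep hb (c • u) x = c * contRep hb u x := by
  refine congrFun (((continuous_contRep hb (c • u)).ae_eq_iff_eq volume
    ((continuous_contRep hb u).const_smul c)).1 ?_) x
  refine (coeFn_ae_eq_contRep hb (c • u)).symm.trans ?_
  exact (Lp.coeFn_smul c (u : L2)).trans ((coeFn_ae_eq_contRep hb u).const_smul c)

theorem trace_ae_eq_contRep {b : ℝ} (hb : 0 < b) (Γ : JordanCurve) (u : landauSpace b 0) :
    (trace b Γ u : ℂ → ℂ) =ᵐ[Γ.arcLength] contRep hb u := by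
  obtain ⟨w, hw, -⟩ := mem_landauSpace_iff.1 u.2
  have h := coeFn_ae_eq_contRep hb u
  rw [← hw] at h ⊢
  exact trace_ae_eq Γ w (continuous_contRep hb u) h

theorem norm_gaussian (c : ℝ) (x : ℂ) : ‖gaussian c x‖ = Real.exp (c * ‖x‖ ^ 2) := by
  rw [gaussian, Complex.norm_real, Real.norm_of_nonneg (Real.exp_pos _).le]

/-- Point evaluations are bounded on the lowest Landau level, uniformly on compact sets. -/
theorem exists_norm_contRep_le {b : ℝ} (hb : 0 < b) {K : Set ℂ} (hK : IsCompact K) :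
    ∃ C : ℝ, 0 ≤ C ∧ ∀ (u : landauSpace b 0), ∀ x ∈ K, ‖contRep hb u x‖ ≤ C * ‖u‖ := by
  obtain ⟨C, R, hC⟩ := exists_norm_le_eLpNorm_of_differentiable
  obtain ⟨r, hr⟩ := hK.isBounded.exists_norm_le
  -- A bound for the inverse Gaussian on all balls of radius `R` centred in `K`, where `K` lies in
  -- the ball of radius `r` about `0`.
  set M := Real.exp (b / 4 * (r + R) ^ 2)
  refine ⟨|C| * M, by positivity, fun u x hx => ?_⟩
  have h1 : ‖contRep hb u x‖ ≤ ‖entirePart hb u x‖ := by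
    rw [contRep, norm_mul, norm_gaussian]
    refine mul_le_of_le_one_left (norm_nonneg _) (Real.exp_le_one_iff.2 ?_)
    have : 0 ≤ b / 4 * ‖x‖ ^ 2 := by positivity
    linarith
  have h2 : eLpNorm (entirePart hb u) 2 (volume.restrict (Metric.closedBall x R))
      ≤ ENNReal.ofReal M * eLpNorm (u : L2) 2 volume := by
    refine (eLpNorm_le_mul_eLpNorm_of_ae_le_mul (g := ((u : L2) : ℂ → ℂ)) ?_ 2).trans
      (mul_le_mul_right (eLpNorm_mono_measure _ Measure.restrict_le_self) _)
    refine (ae_restrict_iff' Metric.isClosed_closedBall.measurableSet).2 ?_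
    filter_upwards [coeFn_ae_eq_contRep hb u] with y hy hyR
    have hyn : ‖y‖ ≤ r + R := by
      calc ‖y‖ = ‖x + (y - x)‖ := by congr 1; ring
        _ ≤ ‖x‖ + ‖y - x‖ := norm_add_le _ _
        _ ≤ r + R := add_le_add (hr x hx) (mem_closedBall_iff_norm.1 hyR)
    have e : entirePart hb u y = gaussian (b / 4) y * (u : L2) y := by
      rw [hy, contRep, ← mul_assoc, mul_comm (gaussian _ _), gaussian_neg_mul, one_mul]
    rw [e, norm_mul, norm_gaussian]
    refine mul_le_mul_of_nonneg_right (Real.exp_le_exp.2 ?_) (norm_nonneg _)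
    gcongr
  have hfin : eLpNorm (u : L2) 2 volume ≠ ⊤ := (Lp.memLp (u : L2)).2.ne
  have h3 := ENNReal.toReal_mono (ENNReal.mul_ne_top ENNReal.ofReal_ne_top hfin) h2
  rw [ENNReal.toReal_mul, ENNReal.toReal_ofReal (Real.exp_pos _).le] at h3
  calc ‖contRep hb u x‖ ≤ C * (eLpNorm (entirePart hb u) 2
        (volume.restrict (Metric.closedBall x R))).toReal :=
        h1.trans (hC _ (differentiable_entirePart hb u) x)
    _ ≤ |C| * (M * ‖u‖) := by
        refine mul_le_mul (le_abs_self C) ?_ ENNReal.toReal_nonneg (abs_nonneg C)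
        exact h3
    _ = |C| * M * ‖u‖ := by ring

/-- A function of the lowest Landau level whose continuous representative vanishes on an infinite
subset of a compact set is zero. -/
theorem eq_zero_of_infinite_zeros {b : ℝ} (hb : 0 < b) {u : landauSpace b 0} {S K : Set ℂ}
    (hK : IsCompact K) (hSK : S ⊆ K) (hS : S.Infinite) (h : ∀ x ∈ S, contRep hb u x = 0) :
    u = 0 := by
  obtain ⟨z, -, hz⟩ := hS.exists_accPt_of_subset_isCompact hK hSK
  have hfr : ∃ᶠ y in 𝓝[≠] z, entirePart hb u y = 0 := by
    refine (accPt_iff_frequently_nhdsNE.1 hz).mono fun y hy => ?_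
    refine (mul_eq_zero.1 (h y hy)).resolve_left fun h0 => ?_
    have := norm_gaussian (-(b / 4)) y
    rw [h0, norm_zero] at this
    exact (Real.exp_pos _).ne this
  have h0 := ((differentiable_entirePart hb u).differentiableOn.analyticOnNhd
    isOpen_univ).eqOn_zero_of_preconnected_of_frequently_eq_zero isPreconnected_univ (mem_univ z)
    hfr
  refine Subtype.ext ((Lp.eq_zero_iff_ae_eq_zero).2 ?_)
  filter_upwards [coeFn_ae_eq_contRep hb u] with x hx
  rw [hx, contRep, h0 (mem_univ x)]
  simp

/-! ### The Toeplitz operator on the lowest Landau level -/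

theorem integrable_mul_contRep {b : ℝ} (hb : 0 < b) (Γ : JordanCurve) {υ : ℂ → ℝ}
    (hυ : Integrable υ Γ.arcLength) (u v : landauSpace b 0) :
    Integrable (fun x => (υ x : ℂ) * contRep hb u x * (starRingEnd ℂ) (contRep hb v x))
      Γ.arcLength := by
  have hcont : Continuous fun x => contRep hb u x * (starRingEnd ℂ) (contRep hb v x) :=
    (continuous_contRep hb u).mul (Complex.continuous_conj.comp (continuous_contRep hb v))
  obtain ⟨C, hC⟩ := Γ.isCompact_carrier.exists_bound_of_continuousOn hcont.continuousOn
  have := hυ.ofReal (𝕜 := ℂ).mul_bdd (c := C) hcont.aestronglyMeasurable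
    ((ae_restrict_iff' Γ.isCompact_carrier.measurableSet).2 (.of_forall hC))
  refine this.congr (.of_forall fun x => ?_)
  simp [mul_assoc]

/-- The Toeplitz operator on the lowest Landau level exists as a bounded operator. -/
theorem exists_isToeplitz {b : ℝ} (hb : 0 < b) (Γ : JordanCurve) {υ : ℂ → ℝ}
    (hυ : Integrable υ Γ.arcLength) : ∃ T, IsToeplitz b Γ υ 0 T := by
  obtain ⟨C, hC0, hC⟩ := exists_norm_contRep_le hb Γ.isCompact_carrier
  have hi := integrable_mul_contRep hb Γ hυ
  let B : landauSpace b 0 →ₗ⋆[ℂ] landauSpace b 0 →ₗ[ℂ] ℂ := LinearMap.mk₂'ₛₗ _ _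
    (fun u v => ∫ x, (υ x : ℂ) * contRep hb v x * (starRingEnd ℂ) (contRep hb u x) ∂Γ.arcLength)
    (fun u u' v => by
      rw [← integral_add (hi v u) (hi v u')]
      exact integral_congr_ae (.of_forall fun x => by
        simp only [contRep_add, map_add]; ring))
    (fun c u v => by
      rw [smul_eq_mul, ← integral_const_mul]
      exact integral_congr_ae (.of_forall fun x => by
        simp only [contRep_smul, map_mul]; ring))
    (fun u v v' => by
      rw [← integral_add (hi v u) (hi v' u)]
      exact integral_congr_ae (.of_forall fun x => by
        simp only [contRep_add]; ring))
    (fun c u v => by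
      rw [RingHom.id_apply, smul_eq_mul, ← integral_const_mul]
      exact integral_congr_ae (.of_forall fun x => by
        simp only [contRep_smul]; ring))
  have hB : ∀ u v, ‖B u v‖ ≤ ((∫ x, ‖υ x‖ ∂Γ.arcLength) * C ^ 2) * ‖u‖ * ‖v‖ := by
    intro u v
    calc ‖B u v‖ ≤ ∫ x, ‖υ x‖ * (C * ‖v‖ * (C * ‖u‖)) ∂Γ.arcLength := by
          refine norm_integral_le_of_norm_le (hυ.norm.mul_const _) ?_
          refine (ae_restrict_iff' Γ.isCompact_carrier.measurableSet).2 (.of_forall fun x hx => ?_)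
          rw [norm_mul, norm_mul, Complex.norm_real, RCLike.norm_conj, mul_assoc]
          gcongr
          · exact hC v x hx
          · exact hC u x hx
      _ = ((∫ x, ‖υ x‖ ∂Γ.arcLength) * C ^ 2) * ‖u‖ * ‖v‖ := by
          rw [integral_mul_const]; ring
  -- The representing operator sits in the first slot of the inner product, whereas `IsToeplitz` has
  -- `T` in the second; hence the adjoint.
  let T := (InnerProductSpace.continuousLinearMapOfBilin (B.mkContinuous₂ _ hB)).adjoint
  refine ⟨T, fun u v => ?_⟩
  have hae : (fun x => (υ x : ℂ) * trace b Γ u x * (starRingEnd ℂ) (trace b Γ v x))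
      =ᵐ[Γ.arcLength]
        fun x => (υ x : ℂ) * contRep hb u x * (starRingEnd ℂ) (contRep hb v x) := by
    filter_upwards [trace_ae_eq_contRep hb Γ u, trace_ae_eq_contRep hb Γ v] with x hx hx'
    rw [hx, hx']
  refine ⟨(hi u v).congr hae.symm, ?_⟩
  rw [ContinuousLinearMap.adjoint_inner_right,
    InnerProductSpace.continuousLinearMapOfBilin_apply, toeplitzForm, integral_congr_ae hae]
  rfl

/-- If the operator annihilates `u`, then `u` vanishes where the weight does not. -/
theorem IsToeplitz.ae_eq_zero_of_apply_eq_zero {b : ℝ} (hb : 0 < b) {Γ : JordanCurve} {υ : ℂ → ℝ}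
    (hυ : Integrable υ Γ.arcLength)
    (hsign : 0 ≤ᵐ[Γ.arcLength] υ ∨ υ ≤ᵐ[Γ.arcLength] 0)
    {T : landauSpace b 0 →L[ℂ] landauSpace b 0} (hT : IsToeplitz b Γ υ 0 T) {u : landauSpace b 0}
    (hu : T u = 0) : ∀ᵐ x ∂Γ.arcLength, υ x ≠ 0 → contRep hb u x = 0 := by
  have hform : ∫ x, υ x * ‖contRep hb u x‖ ^ 2 ∂Γ.arcLength = 0 := by
    have h := (hT u u).2
    rw [hu, inner_zero_right, toeplitzForm] at h
    have hae : (fun x => (υ x : ℂ) * trace b Γ u x * (starRingEnd ℂ) (trace b Γ u x))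
        =ᵐ[Γ.arcLength] fun x => ((υ x * ‖contRep hb u x‖ ^ 2 : ℝ) : ℂ) := by
      filter_upwards [trace_ae_eq_contRep hb Γ u] with x hx
      rw [hx, mul_assoc, Complex.mul_conj']
      push_cast
      rfl
    rw [integral_congr_ae hae, integral_complex_ofReal] at h
    exact_mod_cast h.symm
  have hint : Integrable (fun x => υ x * ‖contRep hb u x‖ ^ 2) Γ.arcLength := by
    refine (integrable_mul_contRep hb Γ hυ u u).re.congr (.of_forall fun x => ?_)
    simp only
    rw [mul_assoc, Complex.mul_conj']
    exact_mod_cast Complex.ofReal_re _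
  have hz : (fun x => υ x * ‖contRep hb u x‖ ^ 2) =ᵐ[Γ.arcLength] 0 := by
    -- Constant sign excludes cancellation, so a vanishing integral forces a vanishing integrand.
    rcases hsign with hs | hs
    · refine (integral_eq_zero_iff_of_nonneg_ae ?_ hint).1 hform
      filter_upwards [hs] with x hx
      exact mul_nonneg hx (sq_nonneg _)
    · have hneg : (fun x => -(υ x * ‖contRep hb u x‖ ^ 2)) =ᵐ[Γ.arcLength] 0 := by
        refine (integral_eq_zero_iff_of_nonneg_ae ?_ hint.neg).1 ((integral_neg _).trans (by
          rw [hform, neg_zero]))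
        filter_upwards [hs] with x hx
        exact neg_nonneg.2 (mul_nonpos_of_nonpos_of_nonneg hx (sq_nonneg _))
      filter_upwards [hneg] with x hx
      exact neg_eq_zero.1 hx
  filter_upwards [hz] with x hx hne
  simpa [hne] using hx

end Landau

end

/-! ### Injectivity on the lowest Landau level -/

theorem mainTheorem2 (b : ℝ) (hb : 0 < b) (Γ : Landau.JordanCurve) (p : ENNReal) (hp : 1 < p)
    (υ : MeasureTheory.Lp ℝ p Γ.arcLength) (hsign : 0 ≤ υ ∨ υ ≤ 0) (hυ : υ ≠ 0) :
    LinearMap.ker (Landau.singularToeplitz b Γ υ 0).toLinearMap = ⊥ := by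
  -- `Γ` has finite length, so `L^p(Γ)` embeds in `L¹(Γ)`.
  have hint : Integrable υ Γ.arcLength := (Lp.memLp υ).integrable hp.le
  have hex := Landau.exists_isToeplitz hb Γ hint
  have hT : Landau.IsToeplitz b Γ υ 0 (Landau.singularToeplitz b Γ υ 0) := by
    rw [Landau.singularToeplitz, dif_pos hex]
    exact hex.choose_spec
  have hs : 0 ≤ᵐ[Γ.arcLength] υ ∨ υ ≤ᵐ[Γ.arcLength] 0 :=
    hsign.imp (Lp.coeFn_nonneg υ).2
      fun h => ((Lp.coeFn_le υ 0).2 h).trans_eq (Lp.coeFn_zero _ _ _)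
  refine (Submodule.eq_bot_iff _).2 fun u hu => ?_
  have hz := hT.ae_eq_zero_of_apply_eq_zero hb hint hs (u := u) hu
  -- A finite zero set would be null for arc length, and then `υ` would vanish almost everywhere.
  have hSinf : {x ∈ Γ.carrier | Landau.contRep hb u x = 0}.Infinite := by
    intro hfin
    refine hυ ((Lp.eq_zero_iff_ae_eq_zero).2 ?_)
    have h0 : ∀ᵐ x ∂Γ.arcLength, x ∉ {x ∈ Γ.carrier | Landau.contRep hb u x = 0} := by
      have := Measure.nullSingletonClass_hausdorff ℂ one_pos
      exact measure_eq_zero_iff_ae_notMem.1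
        (le_antisymm ((Measure.restrict_apply_le _ _).trans (hfin.measure_zero _).le) zero_le)
    filter_upwards [hz, h0, ae_restrict_mem Γ.isCompact_carrier.measurableSet] with x h1 h2 h3
    by_contra hne
    exact h2 ⟨h3, h1 hne⟩
  exact Landau.eq_zero_of_infinite_zeros hb Γ.isCompact_carrier (fun x hx => hx.1) hSinf
    fun x hx => hx.2
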